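/- Let $S$ be a noetherian scheme. An \emph{Ab-category over $S$} is a category $\mathfrak{C}$ internal to the category of $S$-schemes, with object scheme $\mathrm{Ob}$, morphism scheme $\mathrm{Mor}$, and $S$-morphisms $\mathrm{dom},\mathrm{cod}\colon \mathrm{Mor}\to\mathrm{Ob}$, $\mathrm{id}\colon\mathrm{Ob}\to\mathrm{Mor}$, $\mathrm{comp}\colon\mathrm{Mor}\times_{\mathrm{Ob}}\mathrm{Mor}\to\mathrm{Mor}$, together with the structure of a commutative $\mathrm{Ob}\times_S\mathrm{Ob}$-group scheme on $\mathrm{Mor}$ (via $(\mathrm{dom},\mathrm{cod})$) for which composition is biadditive. It is \emph{of finite type} if $\mathrm{Ob}\to S$ and $\mathrm{Mor}\to S$ are of finite type. For $s\in S$ let $\overline{k(s)}$ be an algebraic closure of the residue field $k(s)$, and let $\mathcal{C}_{\bar s}$ be the ordinary Ab-category obtained from the base extension of $\mathfrak{C}$ along $\operatorname{Spec}\overline{k(s)}\to S$ by taking sections over $\operatorname{Spec}\overline{k(s)}$: its objects are the sections of $\mathrm{Ob}\times_S\operatorname{Spec}\overline{k(s)}$, and its morphisms $a\to b$ are the sections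 of $\mathrm{Mor}\times_S\operatorname{Spec}\overline{k(s)}$ with domain $a$ and codomain $b$. For an Ab-category $\mathcal{A}$ let $\mathrm{Ps}(\mathcal{A})$ be its pseudo-abelian envelope, i.e. the Karoubi envelope of the category of formal finite direct sums of objects of $\mathcal{A}$. An Ab-category is \emph{semisimple abelian} if it is abelian and each of its objects is a finite direct sum of simple objects. \textbf{Theorem.} Let $\mathfrak{C}$ be an Ab-category of finite type over the noetherian scheme $S$. Suppose that $Z\subset S$ is a Zariski dense subset such that, for every $s\in Z$, the category $\mathrm{Ps}(\mathcal{C}_{\bar s})$ is semisimple abelian and the endomorphism ring of each of its objects is either zero or infinite. Then there is a dense open subset $U\subset S$ such that $\mathrm{Ps}(\mathcal{C}_{\bar\xi})$ is semisimple abelian for every $\xi\in U$. -/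

import Mathlib

open CategoryTheory Limits AlgebraicGeometry

universe v v' u u'

noncomputable section

/-- A category internal to a category `𝒞` with fibre products.  Composition is written in
diagrammatic order, `comp (f, g) = f ≫ g`, so its source is the fibre product of
`cod : mor ⟶ ob` and `dom : mor ⟶ ob`.  Associativity is stated on generalized elements
`T ⟶ mor`, which amounts to commutativity of the usual diagram on the triple fibre product. -/
structure InternalCategory (𝒞 : Type u) [Category.{v} 𝒞] [HasPullbacks 𝒞] where
  ob : 𝒞
  mor : 𝒞
  dom : mor ⟶ ob
  cod : mor ⟶ ob
  id : ob ⟶ mor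
  comp : pullback cod dom ⟶ mor
  id_dom : id ≫ dom = 𝟙 ob
  id_cod : id ≫ cod = 𝟙 ob
  comp_dom : comp ≫ dom = pullback.fst cod dom ≫ dom
  comp_cod : comp ≫ cod = pullback.snd cod dom ≫ cod
  id_comp : pullback.lift (dom ≫ id) (𝟙 mor)
    (by rw [Category.assoc, id_cod, Category.comp_id, Category.id_comp]) ≫ comp = 𝟙 mor
  comp_id : pullback.lift (𝟙 mor) (cod ≫ id)
    (by rw [Category.assoc, id_dom, Category.comp_id, Category.id_comp]) ≫ comp = 𝟙 mor
  assoc : ∀ {T : 𝒞} (f g h : T ⟶ mor) (hfg : f ≫ cod = g ≫ dom) (hgh : g ≫ cod = h ≫ dom),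
    pullback.lift (pullback.lift f g hfg ≫ comp) h
        (by rw [Category.assoc, comp_cod, pullback.lift_snd_assoc, hgh]) ≫ comp =
      pullback.lift f (pullback.lift g h hgh ≫ comp)
        (by rw [Category.assoc, comp_dom, pullback.lift_fst_assoc, hfg]) ≫ comp

/-- The morphism `(dom, cod) : mor ⟶ ob × ob`. -/
abbrev InternalCategory.ends {𝒞 : Type u} [Category.{v} 𝒞] [HasPullbacks 𝒞] [HasBinaryProducts 𝒞]
    (C : InternalCategory 𝒞) : C.mor ⟶ C.ob ⨯ C.ob :=
  prod.lift C.dom C.cod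

/-- An Ab-category internal to `𝒞`: an internal category together with a commutative group
structure on `mor` over `ob × ob` such that composition is biadditive.  The group axioms and
biadditivity are stated on generalized elements; in `comp_add` and `add_comp` the equations `h₁`
and `h₂` follow from the other ones and only serve to form the morphisms to fibre products. -/
structure InternalAbCategory (𝒞 : Type u) [Category.{v} 𝒞] [HasPullbacks 𝒞]
    [HasBinaryProducts 𝒞] extends InternalCategory 𝒞 where
  add : pullback toInternalCategory.ends toInternalCategory.ends ⟶ mor
  zero : ob ⨯ ob ⟶ mor
  neg : mor ⟶ mor
  add_ends : add ≫ toInternalCategory.ends =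
    pullback.fst toInternalCategory.ends toInternalCategory.ends ≫ toInternalCategory.ends
  zero_ends : zero ≫ toInternalCategory.ends = 𝟙 (ob ⨯ ob)
  neg_ends : neg ≫ toInternalCategory.ends = toInternalCategory.ends
  add_assoc : ∀ {T : 𝒞} (f g h : T ⟶ mor)
    (hfg : f ≫ toInternalCategory.ends = g ≫ toInternalCategory.ends)
    (hgh : g ≫ toInternalCategory.ends = h ≫ toInternalCategory.ends),
    pullback.lift (pullback.lift f g hfg ≫ add) h
        (by rw [Category.assoc, add_ends, pullback.lift_fst_assoc, hfg, hgh]) ≫ add =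
      pullback.lift f (pullback.lift g h hgh ≫ add)
        (by rw [Category.assoc, add_ends, pullback.lift_fst_assoc, hfg]) ≫ add
  add_comm : ∀ {T : 𝒞} (f g : T ⟶ mor)
    (hfg : f ≫ toInternalCategory.ends = g ≫ toInternalCategory.ends),
    pullback.lift f g hfg ≫ add = pullback.lift g f hfg.symm ≫ add
  zero_add : pullback.lift (toInternalCategory.ends ≫ zero) (𝟙 mor)
    (by rw [Category.assoc, zero_ends, Category.comp_id, Category.id_comp]) ≫ add = 𝟙 mor
  neg_add : pullback.lift neg (𝟙 mor) (by rw [neg_ends, Category.id_comp]) ≫ add =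
    toInternalCategory.ends ≫ zero
  comp_add : ∀ {T : 𝒞} (f g g' : T ⟶ mor) (hfg : f ≫ cod = g ≫ dom) (hfg' : f ≫ cod = g' ≫ dom)
    (hgg' : g ≫ toInternalCategory.ends = g' ≫ toInternalCategory.ends)
    (h₁ : f ≫ cod = (pullback.lift g g' hgg' ≫ add) ≫ dom)
    (h₂ : (pullback.lift f g hfg ≫ comp) ≫ toInternalCategory.ends =
      (pullback.lift f g' hfg' ≫ comp) ≫ toInternalCategory.ends),
    pullback.lift f (pullback.lift g g' hgg' ≫ add) h₁ ≫ comp =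
      pullback.lift (pullback.lift f g hfg ≫ comp) (pullback.lift f g' hfg' ≫ comp) h₂ ≫ add
  add_comp : ∀ {T : 𝒞} (f f' g : T ⟶ mor) (hfg : f ≫ cod = g ≫ dom) (hfg' : f' ≫ cod = g ≫ dom)
    (hff' : f ≫ toInternalCategory.ends = f' ≫ toInternalCategory.ends)
    (h₁ : (pullback.lift f f' hff' ≫ add) ≫ cod = g ≫ dom)
    (h₂ : (pullback.lift f g hfg ≫ comp) ≫ toInternalCategory.ends =
      (pullback.lift f' g hfg' ≫ comp) ≫ toInternalCategory.ends),
    pullback.lift (pullback.lift f f' hff' ≫ add) g h₁ ≫ comp =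
      pullback.lift (pullback.lift f g hfg ≫ comp) (pullback.lift f' g hfg' ≫ comp) h₂ ≫ add

/-! ### The ordinary category of points -/

namespace InternalCategory

variable {𝒞 : Type u} [Category.{v} 𝒞] [HasPullbacks 𝒞]

/-- The objects of the category of `T`-points of an internal category: morphisms `T ⟶ ob`. -/
@[ext]
structure Points (C : InternalCategory 𝒞) (T : 𝒞) where
  pt : T ⟶ C.ob

/-- Morphisms `a ⟶ b` between `T`-points: morphisms `h : T ⟶ mor` with
`dom ∘ h = a` and `cod ∘ h = b`. -/
@[ext]
structure Points.Hom {C : InternalCategory 𝒞} {T : 𝒞} (a b : Points C T) where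
  pt : T ⟶ C.mor
  dom : pt ≫ C.dom = a.pt
  cod : pt ≫ C.cod = b.pt

instance Points.category (C : InternalCategory 𝒞) (T : 𝒞) : Category.{v} (Points C T) where
  Hom := Points.Hom
  id a := ⟨a.pt ≫ C.id, by rw [Category.assoc, C.id_dom, Category.comp_id],
    by rw [Category.assoc, C.id_cod, Category.comp_id]⟩
  comp f g := ⟨pullback.lift f.pt g.pt (f.cod.trans g.dom.symm) ≫ C.comp,
    by rw [Category.assoc, C.comp_dom, pullback.lift_fst_assoc, f.dom],
    by rw [Category.assoc, C.comp_cod, pullback.lift_snd_assoc, g.cod]⟩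
  id_comp {a b} f := Points.Hom.ext <| calc
    pullback.lift (a.pt ≫ C.id) f.pt _ ≫ C.comp
      = f.pt ≫ pullback.lift (C.dom ≫ C.id) (𝟙 C.mor) _ ≫ C.comp := by
        rw [← Category.assoc f.pt]
        congr 1
        ext : 1
        · rw [pullback.lift_fst, Category.assoc, pullback.lift_fst]
          rw [← Category.assoc, f.dom]
        · rw [pullback.lift_snd, Category.assoc, pullback.lift_snd]
          rw [Category.comp_id]
    _ = f.pt := by rw [C.id_comp, Category.comp_id]
  comp_id {a b} f := Points.Hom.ext <| calc
    pullback.lift f.pt (b.pt ≫ C.id) _ ≫ C.comp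
      = f.pt ≫ pullback.lift (𝟙 C.mor) (C.cod ≫ C.id) _ ≫ C.comp := by
        rw [← Category.assoc f.pt]
        congr 1
        ext : 1
        · rw [pullback.lift_fst, Category.assoc, pullback.lift_fst]
          rw [Category.comp_id]
        · rw [pullback.lift_snd, Category.assoc, pullback.lift_snd]
          rw [← Category.assoc, f.cod]
    _ = f.pt := by rw [C.comp_id, Category.comp_id]
  assoc f g h := by
    apply Points.Hom.ext
    exact C.assoc f.pt g.pt h.pt _ _

theorem Points.hom_ext {C : InternalCategory 𝒞} {T : 𝒞} {a b : Points C T} {f g : a ⟶ b}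
    (h : Points.Hom.pt f = Points.Hom.pt g) : f = g :=
  Points.Hom.ext h

end InternalCategory

namespace InternalAbCategory

variable {𝒞 : Type u} [Category.{v} 𝒞] [HasPullbacks 𝒞] [HasBinaryProducts 𝒞]

open InternalCategory (Points)

theorem ends_eq (C : InternalAbCategory 𝒞) {T : 𝒞} {f g : T ⟶ C.mor}
    (h₁ : f ≫ C.dom = g ≫ C.dom) (h₂ : f ≫ C.cod = g ≫ C.cod) : f ≫ C.ends = g ≫ C.ends := by
  ext <;> simp [h₁, h₂]

theorem add_dom (C : InternalAbCategory 𝒞) : C.add ≫ C.dom = pullback.fst C.ends C.ends ≫ C.dom := by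
  simpa only [Category.assoc, prod.lift_fst, Category.id_comp] using
    congr($(C.add_ends) ≫ prod.fst)

theorem add_cod (C : InternalAbCategory 𝒞) : C.add ≫ C.cod = pullback.fst C.ends C.ends ≫ C.cod := by
  simpa only [Category.assoc, prod.lift_snd, Category.id_comp] using
    congr($(C.add_ends) ≫ prod.snd)

theorem zero_dom (C : InternalAbCategory 𝒞) : C.zero ≫ C.dom = prod.fst := by
  simpa only [Category.assoc, prod.lift_fst, Category.id_comp] using
    congr($(C.zero_ends) ≫ prod.fst)

theorem zero_cod (C : InternalAbCategory 𝒞) : C.zero ≫ C.cod = prod.snd := by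
  simpa only [Category.assoc, prod.lift_snd, Category.id_comp] using
    congr($(C.zero_ends) ≫ prod.snd)

theorem neg_dom (C : InternalAbCategory 𝒞) : C.neg ≫ C.dom = C.dom := by
  simpa only [Category.assoc, prod.lift_fst, Category.id_comp] using
    congr($(C.neg_ends) ≫ prod.fst)

theorem neg_cod (C : InternalAbCategory 𝒞) : C.neg ≫ C.cod = C.cod := by
  simpa only [Category.assoc, prod.lift_snd, Category.id_comp] using
    congr($(C.neg_ends) ≫ prod.snd)

theorem hom_ends (C : InternalAbCategory 𝒞) {T : 𝒞} {a b : Points C.toInternalCategory T}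
    (f g : Points.Hom a b) : f.pt ≫ C.ends = g.pt ≫ C.ends :=
  C.ends_eq (f.dom.trans g.dom.symm) (f.cod.trans g.cod.symm)

/-- The addition on Hom-sets of `T`-points induced by the group structure. -/
instance homAddCommGroup (C : InternalAbCategory 𝒞) {T : 𝒞} (a b : Points C.toInternalCategory T) :
    AddCommGroup (Points.Hom a b) :=
  letI : Add (Points.Hom a b) := ⟨fun f g => ⟨pullback.lift f.pt g.pt (C.hom_ends f g) ≫ C.add,
    by rw [Category.assoc, C.add_dom, pullback.lift_fst_assoc, f.dom],
    by rw [Category.assoc, C.add_cod, pullback.lift_fst_assoc, f.cod]⟩⟩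
  letI : Zero (Points.Hom a b) := ⟨⟨prod.lift a.pt b.pt ≫ C.zero,
    by rw [Category.assoc, C.zero_dom, prod.lift_fst],
    by rw [Category.assoc, C.zero_cod, prod.lift_snd]⟩⟩
  letI : Neg (Points.Hom a b) := ⟨fun f => ⟨f.pt ≫ C.neg,
    by rw [Category.assoc, C.neg_dom, f.dom],
    by rw [Category.assoc, C.neg_cod, f.cod]⟩⟩
  have hends (f : Points.Hom a b) : f.pt ≫ C.ends = prod.lift a.pt b.pt := by
    ext <;> simp [f.dom, f.cod]
  have hcomm (f g : Points.Hom a b) : f + g = g + f :=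
    Points.Hom.ext (C.add_comm _ _ (C.hom_ends f g))
  have hzero (f : Points.Hom a b) : 0 + f = f := by
    apply Points.Hom.ext
    conv_rhs => rw [← Category.comp_id f.pt, ← C.zero_add]
    rw [← Category.assoc]
    change pullback.lift (prod.lift a.pt b.pt ≫ C.zero) f.pt _ ≫ C.add = _
    congr 1
    ext : 1
    · rw [pullback.lift_fst, Category.assoc, pullback.lift_fst, ← Category.assoc, hends]
    · rw [pullback.lift_snd, Category.assoc, pullback.lift_snd, Category.comp_id]
  have hneg (f : Points.Hom a b) : -f + f = 0 := by
    apply Points.Hom.ext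
    change pullback.lift (f.pt ≫ C.neg) f.pt _ ≫ C.add = prod.lift a.pt b.pt ≫ C.zero
    rw [← hends f, Category.assoc, ← C.neg_add, ← Category.assoc]
    congr 1
    ext : 1
    · rw [pullback.lift_fst, Category.assoc, pullback.lift_fst]
    · rw [pullback.lift_snd, Category.assoc, pullback.lift_snd, Category.comp_id]
  { add_assoc := fun f g h => Points.Hom.ext (C.add_assoc f.pt g.pt h.pt _ _)
    zero_add := hzero
    add_zero := fun f => (hcomm f 0).trans (hzero f)
    neg_add_cancel := hneg
    add_comm := hcomm
    nsmul := nsmulRec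
    zsmul := zsmulRec }

/-- The category of `T`-points of an internal Ab-category is an Ab-category. -/
instance pointsPreadditive (C : InternalAbCategory 𝒞) (T : 𝒞) :
    Preadditive (Points C.toInternalCategory T) where
  homGroup a b := C.homAddCommGroup a b
  add_comp _ _ _ f f' g := Points.hom_ext (C.add_comp f.pt f'.pt g.pt _ _ _ _ _)
  comp_add _ _ _ f g g' := Points.hom_ext (C.comp_add f.pt g.pt g'.pt _ _ _ _ _)

end InternalAbCategory

/-! ### Base extension -/

section map

variable {𝒞 : Type u} [Category.{v} 𝒞] {𝒟 : Type u'} [Category.{v'} 𝒟] {L : 𝒟 ⥤ 𝒞} {F : 𝒞 ⥤ 𝒟}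

/-- A right adjoint functor `F` preserves products: the canonical morphism
`F X × F Y ⟶ F (X × Y)`. -/
def prodToMap [HasBinaryProducts 𝒞] [HasBinaryProducts 𝒟] (adj : L ⊣ F) (X Y : 𝒞) :
    F.obj X ⨯ F.obj Y ⟶ F.obj (X ⨯ Y) :=
  haveI := adj.rightAdjoint_preservesLimits.{0, 0}
  (PreservesLimitPair.iso F X Y).inv

theorem prodToMap_fst [HasBinaryProducts 𝒞] [HasBinaryProducts 𝒟] (adj : L ⊣ F) (X Y : 𝒞) :
    prodToMap adj X Y ≫ F.map (prod.fst : X ⨯ Y ⟶ X) = prod.fst := by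
  have := adj.rightAdjoint_preservesLimits.{0, 0}
  rw [prodToMap, Iso.inv_comp_eq, PreservesLimitPair.iso_hom, prodComparison_fst]

theorem prodToMap_snd [HasBinaryProducts 𝒞] [HasBinaryProducts 𝒟] (adj : L ⊣ F) (X Y : 𝒞) :
    prodToMap adj X Y ≫ F.map (prod.snd : X ⨯ Y ⟶ Y) = prod.snd := by
  have := adj.rightAdjoint_preservesLimits.{0, 0}
  rw [prodToMap, Iso.inv_comp_eq, PreservesLimitPair.iso_hom, prodComparison_snd]

/-- Generalized elements of `F Y` are images of generalized elements of `Y`. -/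
theorem exists_homEquiv (adj : L ⊣ F) {T : 𝒟} {Y : 𝒞} (f : T ⟶ F.obj Y) :
    ∃ g : L.obj T ⟶ Y, f = adj.homEquiv T Y g :=
  ⟨(adj.homEquiv T Y).symm f, by simp⟩

theorem homEquiv_comp_map (adj : L ⊣ F) {T : 𝒟} {X Y : 𝒞} (f : L.obj T ⟶ X) (g : X ⟶ Y) :
    adj.homEquiv T X f ≫ F.map g = adj.homEquiv T Y (f ≫ g) :=
  (adj.homEquiv_naturality_right f g).symm

variable [HasPullbacks 𝒞] [HasPullbacks 𝒟]

/-- A right adjoint functor `F` preserves fibre products: the canonical morphism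
`F X ×_{F Z} F Y ⟶ F (X ×_Z Y)`. -/
def pullbackToMap (adj : L ⊣ F) {X Y Z : 𝒞} (f : X ⟶ Z) (g : Y ⟶ Z) :
    pullback (F.map f) (F.map g) ⟶ F.obj (pullback f g) :=
  haveI := adj.rightAdjoint_preservesLimits.{0, 0}
  (PreservesPullback.iso F f g).inv

theorem pullbackToMap_fst (adj : L ⊣ F) {X Y Z : 𝒞} (f : X ⟶ Z) (g : Y ⟶ Z) :
    pullbackToMap adj f g ≫ F.map (pullback.fst f g) = pullback.fst (F.map f) (F.map g) := by
  have := adj.rightAdjoint_preservesLimits.{0, 0}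
  rw [pullbackToMap, Iso.inv_comp_eq, PreservesPullback.iso_hom_fst]

theorem pullbackToMap_snd (adj : L ⊣ F) {X Y Z : 𝒞} (f : X ⟶ Z) (g : Y ⟶ Z) :
    pullbackToMap adj f g ≫ F.map (pullback.snd f g) = pullback.snd (F.map f) (F.map g) := by
  have := adj.rightAdjoint_preservesLimits.{0, 0}
  rw [pullbackToMap, Iso.inv_comp_eq, PreservesPullback.iso_hom_snd]

theorem lift_homEquiv_pullbackToMap (adj : L ⊣ F) {T : 𝒟} {X Y Z : 𝒞} {f : X ⟶ Z} {g : Y ⟶ Z}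
    (x : L.obj T ⟶ X) (y : L.obj T ⟶ Y) (h : x ≫ f = y ≫ g)
    (h' : adj.homEquiv T X x ≫ F.map f = adj.homEquiv T Y y ≫ F.map g) :
    pullback.lift (adj.homEquiv T X x) (adj.homEquiv T Y y) h' ≫ pullbackToMap adj f g =
      adj.homEquiv T _ (pullback.lift x y h) := by
  have := adj.rightAdjoint_preservesLimits.{0, 0}
  rw [pullbackToMap, Iso.comp_inv_eq]
  ext : 1
  · rw [pullback.lift_fst, Category.assoc, PreservesPullback.iso_hom_fst, homEquiv_comp_map,
      pullback.lift_fst]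
  · rw [pullback.lift_snd, Category.assoc, PreservesPullback.iso_hom_snd, homEquiv_comp_map,
      pullback.lift_snd]

theorem lift_homEquiv_comp (adj : L ⊣ F) {T : 𝒟} {X Y Z W : 𝒞} {f : X ⟶ Z} {g : Y ⟶ Z}
    (m : pullback f g ⟶ W) (x : L.obj T ⟶ X) (y : L.obj T ⟶ Y) (h : x ≫ f = y ≫ g)
    (h' : adj.homEquiv T X x ≫ F.map f = adj.homEquiv T Y y ≫ F.map g) :
    pullback.lift (adj.homEquiv T X x) (adj.homEquiv T Y y) h' ≫
        pullbackToMap adj f g ≫ F.map m =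
      adj.homEquiv T W (pullback.lift x y h ≫ m) := by
  rw [← Category.assoc, lift_homEquiv_pullbackToMap adj x y h, homEquiv_comp_map]

theorem lift_map_comp (adj : L ⊣ F) {T X Y Z W : 𝒞} {f : X ⟶ Z} {g : Y ⟶ Z}
    (m : pullback f g ⟶ W) (x : T ⟶ X) (y : T ⟶ Y) (h : x ≫ f = y ≫ g)
    {x' : F.obj T ⟶ F.obj X} {y' : F.obj T ⟶ F.obj Y} (hx : x' = F.map x) (hy : y' = F.map y)
    (h' : x' ≫ F.map f = y' ≫ F.map g) :
    pullback.lift x' y' h' ≫ pullbackToMap adj f g ≫ F.map m =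
      F.map (pullback.lift x y h ≫ m) := by
  have := adj.rightAdjoint_preservesLimits.{0, 0}
  rw [F.map_comp, ← Category.assoc]
  congr 1
  rw [pullbackToMap, Iso.comp_inv_eq]
  ext : 1
  · rw [pullback.lift_fst, Category.assoc, PreservesPullback.iso_hom_fst, ← F.map_comp,
      pullback.lift_fst, hx]
  · rw [pullback.lift_snd, Category.assoc, PreservesPullback.iso_hom_snd, ← F.map_comp,
      pullback.lift_snd, hy]

section binaryProducts

variable [HasBinaryProducts 𝒞] [HasBinaryProducts 𝒟]

theorem lift_map_prodToMap (adj : L ⊣ F) {X A B : 𝒞} (a : X ⟶ A) (b : X ⟶ B) :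
    prod.lift (F.map a) (F.map b) ≫ prodToMap adj A B = F.map (prod.lift a b) := by
  have := adj.rightAdjoint_preservesLimits.{0, 0}
  rw [prodToMap, Iso.comp_inv_eq, PreservesLimitPair.iso_hom]
  ext : 1
  · rw [prod.lift_fst, Category.assoc, prodComparison_fst, ← F.map_comp, prod.lift_fst]
  · rw [prod.lift_snd, Category.assoc, prodComparison_snd, ← F.map_comp, prod.lift_snd]

theorem comp_map_lift_congr (adj : L ⊣ F) {T : 𝒟} {X A B : 𝒞} {a : X ⟶ A} {b : X ⟶ B}
    {f g : T ⟶ F.obj X} (h : f ≫ prod.lift (F.map a) (F.map b) = g ≫ prod.lift (F.map a) (F.map b)) :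
    f ≫ F.map (prod.lift a b) = g ≫ F.map (prod.lift a b) := by
  rw [← lift_map_prodToMap adj, ← Category.assoc, h, Category.assoc]

/-- A morphism `m` on `X ×_{A × B} X` induces one on `F X ×_{F A × F B} F X`. -/
def mapAdd (adj : L ⊣ F) {X A B W : 𝒞} (a : X ⟶ A) (b : X ⟶ B)
    (m : pullback (prod.lift a b) (prod.lift a b) ⟶ W) :
    pullback (prod.lift (F.map a) (F.map b)) (prod.lift (F.map a) (F.map b)) ⟶ F.obj W :=
  pullback.lift (pullback.fst _ _) (pullback.snd _ _)
      (comp_map_lift_congr adj pullback.condition) ≫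
    pullbackToMap adj (prod.lift a b) (prod.lift a b) ≫ F.map m

theorem lift_mapAdd (adj : L ⊣ F) {T : 𝒟} {X A B W : 𝒞} (a : X ⟶ A) (b : X ⟶ B)
    (m : pullback (prod.lift a b) (prod.lift a b) ⟶ W) (x y : T ⟶ F.obj X)
    (h : x ≫ prod.lift (F.map a) (F.map b) = y ≫ prod.lift (F.map a) (F.map b)) :
    pullback.lift x y h ≫ mapAdd adj a b m =
      pullback.lift x y (comp_map_lift_congr adj h) ≫
        pullbackToMap adj (prod.lift a b) (prod.lift a b) ≫ F.map m := by
  rw [mapAdd, ← Category.assoc]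
  congr 1
  ext : 1
  · rw [Category.assoc, pullback.lift_fst, pullback.lift_fst, pullback.lift_fst]
  · rw [Category.assoc, pullback.lift_snd, pullback.lift_snd, pullback.lift_snd]

theorem lift_homEquiv_mapAdd (adj : L ⊣ F) {T : 𝒟} {X A B W : 𝒞} (a : X ⟶ A) (b : X ⟶ B)
    (m : pullback (prod.lift a b) (prod.lift a b) ⟶ W) (x y : L.obj T ⟶ X)
    (h : x ≫ prod.lift a b = y ≫ prod.lift a b)
    (h' : adj.homEquiv T X x ≫ prod.lift (F.map a) (F.map b) =
      adj.homEquiv T X y ≫ prod.lift (F.map a) (F.map b)) :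
    pullback.lift (adj.homEquiv T X x) (adj.homEquiv T X y) h' ≫ mapAdd adj a b m =
      adj.homEquiv T W (pullback.lift x y h ≫ m) := by
  rw [lift_mapAdd, lift_homEquiv_comp adj m x y h]

theorem lift_congr_of_homEquiv (adj : L ⊣ F) {T : 𝒟} {X A B : 𝒞} {a : X ⟶ A} {b : X ⟶ B}
    {x y : L.obj T ⟶ X}
    (h : adj.homEquiv T X x ≫ prod.lift (F.map a) (F.map b) =
      adj.homEquiv T X y ≫ prod.lift (F.map a) (F.map b)) :
    x ≫ prod.lift a b = y ≫ prod.lift a b := by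
  have := comp_map_lift_congr adj h
  rwa [homEquiv_comp_map, homEquiv_comp_map, EmbeddingLike.apply_eq_iff_eq] at this

theorem mapAdd_comp_map (adj : L ⊣ F) {X A B W V : 𝒞} (a : X ⟶ A) (b : X ⟶ B)
    (m : pullback (prod.lift a b) (prod.lift a b) ⟶ W) (w : W ⟶ V) (c : X ⟶ V)
    (h : m ≫ w = pullback.fst _ _ ≫ c) :
    mapAdd adj a b m ≫ F.map w = pullback.fst _ _ ≫ F.map c := by
  rw [mapAdd, Category.assoc, Category.assoc, ← F.map_comp, h, F.map_comp,
    ← Category.assoc (pullbackToMap adj _ _), pullbackToMap_fst, ← Category.assoc,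
    pullback.lift_fst]

end binaryProducts

/-- The image of an internal category under a right adjoint functor. -/
abbrev InternalCategory.map (adj : L ⊣ F) (C : InternalCategory 𝒞) : InternalCategory 𝒟 where
  ob := F.obj C.ob
  mor := F.obj C.mor
  dom := F.map C.dom
  cod := F.map C.cod
  id := F.map C.id
  comp := pullbackToMap adj C.cod C.dom ≫ F.map C.comp
  id_dom := by rw [← F.map_comp, C.id_dom, F.map_id]
  id_cod := by rw [← F.map_comp, C.id_cod, F.map_id]
  comp_dom := by
    rw [Category.assoc, ← F.map_comp, C.comp_dom, F.map_comp, ← Category.assoc, pullbackToMap_fst]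
  comp_cod := by
    rw [Category.assoc, ← F.map_comp, C.comp_cod, F.map_comp, ← Category.assoc, pullbackToMap_snd]
  id_comp := by
    rw [lift_map_comp adj C.comp (C.dom ≫ C.id) (𝟙 C.mor)
      (by rw [Category.assoc, C.id_cod, Category.comp_id, Category.id_comp])
      (F.map_comp _ _).symm (F.map_id _).symm, C.id_comp, F.map_id]
  comp_id := by
    rw [lift_map_comp adj C.comp (𝟙 C.mor) (C.cod ≫ C.id)
      (by rw [Category.assoc, C.id_dom, Category.comp_id, Category.id_comp])
      (F.map_id _).symm (F.map_comp _ _).symm, C.comp_id, F.map_id]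
  assoc {T} f g h hfg hgh := by
    obtain ⟨f, rfl⟩ := exists_homEquiv adj f
    obtain ⟨g, rfl⟩ := exists_homEquiv adj g
    obtain ⟨h, rfl⟩ := exists_homEquiv adj h
    have hfg' : f ≫ C.cod = g ≫ C.dom := by simpa [homEquiv_comp_map] using hfg
    have hgh' : g ≫ C.cod = h ≫ C.dom := by simpa [homEquiv_comp_map] using hgh
    simp only [lift_homEquiv_comp adj C.comp f g hfg', lift_homEquiv_comp adj C.comp g h hgh']
    rw [lift_homEquiv_comp adj C.comp _ _ (by rw [Category.assoc, C.comp_cod, pullback.lift_snd_assoc, hgh']),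
      lift_homEquiv_comp adj C.comp _ _ (by rw [Category.assoc, C.comp_dom, pullback.lift_fst_assoc, hfg']), C.assoc f g h hfg' hgh']


namespace InternalAbCategory

variable [HasBinaryProducts 𝒞] [HasBinaryProducts 𝒟]

/-- The image of an internal Ab-category under a right adjoint functor. -/
abbrev map (adj : L ⊣ F) (C : InternalAbCategory 𝒞) : InternalAbCategory 𝒟 where
  toInternalCategory := C.toInternalCategory.map adj
  add := mapAdd adj C.dom C.cod C.add
  zero := prodToMap adj C.ob C.ob ≫ F.map C.zero
  neg := F.map C.neg
  add_ends := by
    ext : 1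
    · simp only [Category.assoc, prod.lift_fst]
      exact mapAdd_comp_map adj _ _ _ _ _ C.add_dom
    · simp only [Category.assoc, prod.lift_snd]
      exact mapAdd_comp_map adj _ _ _ _ _ C.add_cod
  zero_ends := by
    ext : 1
    · simp only [Category.assoc, prod.lift_fst, Category.id_comp]
      rw [← F.map_comp, C.zero_dom, prodToMap_fst]
    · simp only [Category.assoc, prod.lift_snd, Category.id_comp]
      rw [← F.map_comp, C.zero_cod, prodToMap_snd]
  neg_ends := by
    ext : 1
    · simp only [Category.assoc, prod.lift_fst]
      rw [← F.map_comp, C.neg_dom]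
    · simp only [Category.assoc, prod.lift_snd]
      rw [← F.map_comp, C.neg_cod]
  add_assoc {T} f g h hfg hgh := by
    obtain ⟨f, rfl⟩ := exists_homEquiv adj f
    obtain ⟨g, rfl⟩ := exists_homEquiv adj g
    obtain ⟨h, rfl⟩ := exists_homEquiv adj h
    have hfg' := lift_congr_of_homEquiv adj hfg
    have hgh' := lift_congr_of_homEquiv adj hgh
    simp only [lift_homEquiv_mapAdd adj _ _ C.add f g hfg',
      lift_homEquiv_mapAdd adj _ _ C.add g h hgh']
    rw [lift_homEquiv_mapAdd adj _ _ C.add _ _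
        (by rw [Category.assoc, C.add_ends, pullback.lift_fst_assoc, hfg', hgh']),
      lift_homEquiv_mapAdd adj _ _ C.add _ _
        (by rw [Category.assoc, C.add_ends, pullback.lift_fst_assoc, hfg']),
      C.add_assoc f g h hfg' hgh']
  add_comm {T} f g hfg := by
    obtain ⟨f, rfl⟩ := exists_homEquiv adj f
    obtain ⟨g, rfl⟩ := exists_homEquiv adj g
    have hfg' := lift_congr_of_homEquiv adj hfg
    rw [lift_homEquiv_mapAdd adj _ _ C.add f g hfg',
      lift_homEquiv_mapAdd adj _ _ C.add g f hfg'.symm, C.add_comm f g hfg']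
  zero_add := by
    rw [lift_mapAdd, lift_map_comp adj C.add (C.ends ≫ C.zero) (𝟙 C.mor)
      (by rw [Category.assoc, C.zero_ends, Category.comp_id, Category.id_comp]) ?_
      (F.map_id _).symm, C.zero_add, F.map_id]
    rw [← Category.assoc, lift_map_prodToMap, F.map_comp]
  neg_add := by
    rw [lift_mapAdd, lift_map_comp adj C.add C.neg (𝟙 C.mor)
      (by rw [C.neg_ends, Category.id_comp]) rfl
      (F.map_id _).symm, C.neg_add, ← Category.assoc, lift_map_prodToMap, F.map_comp]
  comp_add {T} f g g' hfg hfg' hgg' h₁ h₂ := by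
    obtain ⟨f, rfl⟩ := exists_homEquiv adj f
    obtain ⟨g, rfl⟩ := exists_homEquiv adj g
    obtain ⟨g', rfl⟩ := exists_homEquiv adj g'
    have hf : f ≫ C.cod = g ≫ C.dom := by simpa [homEquiv_comp_map] using hfg
    have hf' : f ≫ C.cod = g' ≫ C.dom := by simpa [homEquiv_comp_map] using hfg'
    have hg := lift_congr_of_homEquiv adj hgg'
    have k₁ : f ≫ C.cod = (pullback.lift g g' hg ≫ C.add) ≫ C.dom := by
      rw [Category.assoc, C.add_dom, pullback.lift_fst_assoc, hf]
    have k₂ : (pullback.lift f g hf ≫ C.comp) ≫ C.ends =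
        (pullback.lift f g' hf' ≫ C.comp) ≫ C.ends := by
      apply C.ends_eq
      · simp only [Category.assoc, C.comp_dom, pullback.lift_fst_assoc]
      · simp only [Category.assoc, C.comp_cod, pullback.lift_snd_assoc]
        simpa only [Category.assoc, prod.lift_snd] using congr($hg ≫ prod.snd)
    simp only [lift_homEquiv_comp adj C.comp f g hf, lift_homEquiv_comp adj C.comp f g' hf',
      lift_homEquiv_mapAdd adj _ _ C.add g g' hg]
    rw [lift_homEquiv_comp adj C.comp _ _ k₁, lift_homEquiv_mapAdd adj _ _ C.add _ _ k₂,
      C.comp_add f g g' hf hf' hg k₁ k₂]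
  add_comp {T} f f' g hfg hfg' hff' h₁ h₂ := by
    obtain ⟨f, rfl⟩ := exists_homEquiv adj f
    obtain ⟨f', rfl⟩ := exists_homEquiv adj f'
    obtain ⟨g, rfl⟩ := exists_homEquiv adj g
    have hf : f ≫ C.cod = g ≫ C.dom := by simpa [homEquiv_comp_map] using hfg
    have hf' : f' ≫ C.cod = g ≫ C.dom := by simpa [homEquiv_comp_map] using hfg'
    have hff := lift_congr_of_homEquiv adj hff'
    have k₁ : (pullback.lift f f' hff ≫ C.add) ≫ C.cod = g ≫ C.dom := by
      rw [Category.assoc, C.add_cod, pullback.lift_fst_assoc, hf]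
    have k₂ : (pullback.lift f g hf ≫ C.comp) ≫ C.ends =
        (pullback.lift f' g hf' ≫ C.comp) ≫ C.ends := by
      apply C.ends_eq
      · simp only [Category.assoc, C.comp_dom, pullback.lift_fst_assoc]
        simpa only [Category.assoc, prod.lift_fst] using congr($hff ≫ prod.fst)
      · simp only [Category.assoc, C.comp_cod, pullback.lift_snd_assoc]
    simp only [lift_homEquiv_comp adj C.comp f g hf, lift_homEquiv_comp adj C.comp f' g hf',
      lift_homEquiv_mapAdd adj _ _ C.add f f' hff]
    rw [lift_homEquiv_comp adj C.comp _ _ k₁, lift_homEquiv_mapAdd adj _ _ C.add _ _ k₂,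
      C.add_comp f f' g hf hf' hff k₁ k₂]

end InternalAbCategory

end map

/-! ### Ab-categories over a scheme -/

/-- An Ab-category over a scheme `S`: an Ab-category internal to `S`-schemes. -/
abbrev SchemeAbCategory (S : Scheme.{u}) := InternalAbCategory (Over S)

namespace SchemeAbCategory

variable {S : Scheme.{u}}

/-- An Ab-category over `S` is of finite type if its schemes of objects and of morphisms are of
finite type over `S`. -/
structure IsFiniteType (C : SchemeAbCategory S) : Prop where
  ob_locallyOfFiniteType : LocallyOfFiniteType C.ob.hom
  ob_quasiCompact : QuasiCompact C.ob.hom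
  mor_locallyOfFiniteType : LocallyOfFiniteType C.mor.hom
  mor_quasiCompact : QuasiCompact C.mor.hom

/-- Base extension along `T ⟶ S`, i.e. the image under `X ↦ X ×_S T`. -/
def baseChange (C : SchemeAbCategory S) {T : Scheme.{u}} (t : T ⟶ S) : SchemeAbCategory T :=
  InternalAbCategory.map (Over.mapPullbackAdj t) C

/-- The ordinary Ab-category of `S`-sections: its objects are the sections `S ⟶ ob`, and the
morphisms from `a` to `b` are the sections `h : S ⟶ mor` with `dom ∘ h = a` and `cod ∘ h = b`. -/
abbrev Sections (C : SchemeAbCategory S) : Type u :=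
  InternalCategory.Points C.toInternalCategory (Over.mk (𝟙 S))

end SchemeAbCategory

/-- The geometric point `Spec k(s)‾ ⟶ S` over `s`. -/
def geometricPoint (S : Scheme.{u}) (s : S) :
    Spec (CommRingCat.of (AlgebraicClosure (S.residueField s))) ⟶ S :=
  Spec.map (CommRingCat.ofHom
    (algebraMap (S.residueField s) (AlgebraicClosure (S.residueField s)))) ≫
    S.fromSpecResidueField s

/-- The ordinary Ab-category of sections of the geometric fibre of `C` over `s`. -/
abbrev SchemeAbCategory.GeometricFiber {S : Scheme.{u}} (C : SchemeAbCategory S) (s : S) : Type u :=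
  (C.baseChange (geometricPoint S s)).Sections

/-! ### Pseudo-abelian envelopes and semisimplicity -/

/-- The pseudo-abelian envelope of an Ab-category: the Karoubi envelope of the additive envelope,
the latter being the category of formal finite direct sums and matrices of morphisms. -/
abbrev PseudoAbelianEnvelope (A : Type u) [Category.{v} A] [Preadditive A] :=
  Idempotents.Karoubi (Mat_ A)

/-- A semisimple abelian category: an abelian category (for the given addition of morphisms) in
which every object is a finite direct sum of simple objects. -/
structure IsSemisimpleAbelian (A : Type u) [Category.{v} A] [Preadditive A] : Prop where
  hasFiniteProducts : HasFiniteProducts A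
  hasKernels : HasKernels A
  hasCokernels : HasCokernels A
  isNormalMono : IsNormalMonoCategory A
  isNormalEpi : IsNormalEpiCategory A
  exists_simple_decomposition : ∀ X : A, ∃ (n : ℕ) (Y : Fin n → A) (b : Bicone Y),
    (∀ i, Simple (Y i)) ∧ Nonempty b.IsBilimit ∧ Nonempty (X ≅ b.pt)

end

/-! Semisimplicity of the pseudo-abelian envelope is reduced to a first-order condition on
morphisms. If `Ps(A)` is semisimple abelian, Schur's lemma makes every morphism `f` of `A` von
Neumann regular: `f ≫ g ≫ f = f` for some `g`. Conversely, suppose that all morphisms of `A` are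
regular and that idempotent endomorphisms of each object satisfy the descending chain condition.
Regularity passes to matrices and to the Karoubi envelope, where it makes kernels and cokernels
split. The chain condition then cuts every object into finitely many simple summands
(`isSemisimpleAbelian_pseudoAbelianEnvelope`).

For the geometric fibres of a finite type Ab-category the chain condition is automatic: idempotents
are compared through closed subsets of the noetherian scheme of endomorphisms
(`wellFounded_idempotentLT`). Only regularity varies with `s`. Pairs `(f, g)` with `f ≫ g ≫ f = f`
form a scheme of finite type over `S`, so by Chevalley's theorem the non-regular locus in `Mor`, and
then its image in `S`, are constructible. Hence the set of `s` with regular fibre is constructible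
(`exists_isConstructible`). It contains `Z`, so it is dense, and a dense constructible set has dense
interior. -/

noncomputable section

/-! ### Von Neumann regular morphisms -/

section Regular

variable {B : Type u} [Category.{v} B]

/-- A morphism `f` is von Neumann regular if `f ≫ g ≫ f = f` for some `g`. -/
def IsVonNeumannRegular {X Y : B} (f : X ⟶ Y) : Prop :=
  ∃ g : Y ⟶ X, f ≫ g ≫ f = f

theorem IsVonNeumannRegular.of_isIso {X Y : B} (f : X ⟶ Y) [IsIso f] : IsVonNeumannRegular f :=
  ⟨inv f, by simp⟩

theorem IsVonNeumannRegular.of_map {B' : Type u'} [Category.{v'} B'] (F : B ⥤ B') [F.Full]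
    [F.Faithful] {X Y : B} {f : X ⟶ Y} (h : IsVonNeumannRegular (F.map f)) :
    IsVonNeumannRegular f := by
  obtain ⟨g, hg⟩ := h
  exact ⟨F.preimage g, F.map_injective (by simpa using hg)⟩

theorem IsVonNeumannRegular.map {B' : Type u'} [Category.{v'} B'] (F : B ⥤ B') {X Y : B}
    {f : X ⟶ Y} (h : IsVonNeumannRegular f) : IsVonNeumannRegular (F.map f) := by
  obtain ⟨g, hg⟩ := h
  exact ⟨F.map g, by rw [← F.map_comp, ← F.map_comp, hg]⟩

variable (B) in
/-- All morphisms of a category are von Neumann regular. -/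
def IsVonNeumannRegularCategory : Prop :=
  ∀ ⦃X Y : B⦄ (f : X ⟶ Y), IsVonNeumannRegular f

theorem IsVonNeumannRegularCategory.karoubi (h : IsVonNeumannRegularCategory B) :
    IsVonNeumannRegularCategory (Idempotents.Karoubi B) := by
  intro P Q f
  obtain ⟨g, hg⟩ := h f.f
  refine ⟨⟨Q.p ≫ g ≫ P.p, by simp⟩, ?_⟩
  ext
  simpa using hg

theorem IsVonNeumannRegularCategory.exists_retraction (h : IsVonNeumannRegularCategory B)
    {X Y : B} (f : X ⟶ Y) [Mono f] : ∃ g : Y ⟶ X, f ≫ g = 𝟙 X := by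
  obtain ⟨g, hg⟩ := h f
  exact ⟨g, by simpa [← cancel_mono f] using hg⟩

/-- The strict order on idempotent endomorphisms of an object: `e'` splits off a proper direct
summand of the direct summand split off by `e`. -/
def IdempotentLT {X : B} (e' e : X ⟶ X) : Prop :=
  e' ≫ e' = e' ∧ e ≫ e = e ∧ e' ≫ e = e' ∧ e ≫ e' = e' ∧ e' ≠ e

theorem wellFounded_idempotentLT_of_map {B' : Type u'} [Category.{v'} B']
    (F : B ⥤ B') [F.Full] [F.Faithful] (X : B)
    (h : WellFounded (IdempotentLT (X := X))) : WellFounded (IdempotentLT (X := F.obj X)) := by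
  refine Subrelation.wf (fun {e' e} hlt => ?_) (InvImage.wf (F.preimage (X := X) (Y := X)) h)
  obtain ⟨e', rfl⟩ := F.map_surjective e'
  obtain ⟨e, rfl⟩ := F.map_surjective e
  simp only [InvImage, Functor.preimage_map]
  obtain ⟨h₁, h₂, h₃, h₄, h₅⟩ := hlt
  simp only [← F.map_comp, F.map_injective.eq_iff] at h₁ h₂ h₃ h₄
  exact ⟨h₁, h₂, h₃, h₄, fun h => h₅ (by rw [h])⟩

variable [Preadditive B]

theorem IsVonNeumannRegular.zero (X Y : B) : IsVonNeumannRegular (0 : X ⟶ Y) :=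
  ⟨0, by simp⟩

/-- McCoy's lemma: it allows a morphism to be corrected one component at a time. -/
theorem IsVonNeumannRegular.of_sub {X Y : B} {f : X ⟶ Y} (g : Y ⟶ X)
    (h : IsVonNeumannRegular (f - f ≫ g ≫ f)) : IsVonNeumannRegular f := by
  obtain ⟨k, hk⟩ := h
  -- This is `g + (1 - g ≫ f) ≫ k ≫ (1 - f ≫ g)` expanded. Sandwiched between two copies of `f`, the
  -- second term becomes `h ≫ k ≫ h = h` with `h = f - f ≫ g ≫ f`.
  refine ⟨g + k - k ≫ f ≫ g - g ≫ f ≫ k + g ≫ f ≫ k ≫ f ≫ g, ?_⟩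
  rw [eq_sub_iff_add_eq] at hk
  conv_rhs => rw [← hk]
  simp only [Preadditive.comp_sub, Preadditive.sub_comp, Preadditive.comp_add,
    Preadditive.add_comp, Category.assoc]
  abel

/-- Induction on the set of components `i j ≫ f` that may be nonzero. A quasi-inverse of one
component, used in `of_sub`, kills that component and keeps the vanishing ones zero. -/
theorem IsVonNeumannRegular.of_source {X Y : B} {J : Type*} [Finite J] (W : J → B)
    (i : ∀ j, W j ⟶ X) (hi : ∀ f : X ⟶ Y, (∀ j, i j ≫ f = 0) → f = 0)
    (h : ∀ j (f : W j ⟶ Y), IsVonNeumannRegular f) (f : X ⟶ Y) : IsVonNeumannRegular f := by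
  classical
  have := Fintype.ofFinite J
  suffices H : ∀ (s : Finset J) (f : X ⟶ Y), (∀ j ∉ s, i j ≫ f = 0) → IsVonNeumannRegular f from
    H Finset.univ f fun j hj => absurd (Finset.mem_univ j) hj
  intro s
  induction s using Finset.induction_on with
  | empty =>
    intro f hf
    rw [hi f fun j => hf j (by simp)]
    exact .zero _ _
  | insert j₀ s _ ih =>
    intro f hf
    obtain ⟨g, hg⟩ := h j₀ (i j₀ ≫ f)
    refine .of_sub (g ≫ i j₀) (ih _ fun j hj => ?_)
    rw [Preadditive.comp_sub, sub_eq_zero]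
    by_cases hjj : j = j₀
    · subst hjj
      simpa using hg.symm
    · have : i j ≫ f = 0 := hf j (by simp [hjj, hj])
      rw [reassoc_of% this, this, zero_comp]

theorem IsVonNeumannRegular.of_target {X Y : B} {J : Type*} [Finite J] (W : J → B)
    (p : ∀ j, Y ⟶ W j) (hp : ∀ f : X ⟶ Y, (∀ j, f ≫ p j = 0) → f = 0)
    (h : ∀ j (f : X ⟶ W j), IsVonNeumannRegular f) (f : X ⟶ Y) : IsVonNeumannRegular f := by
  classical
  have := Fintype.ofFinite J
  suffices H : ∀ (s : Finset J) (f : X ⟶ Y), (∀ j ∉ s, f ≫ p j = 0) → IsVonNeumannRegular f from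
    H Finset.univ f fun j hj => absurd (Finset.mem_univ j) hj
  intro s
  induction s using Finset.induction_on with
  | empty =>
    intro f hf
    rw [hp f fun j => hf j (by simp)]
    exact .zero _ _
  | insert j₀ s _ ih =>
    intro f hf
    obtain ⟨g, hg⟩ := h j₀ (f ≫ p j₀)
    refine .of_sub (p j₀ ≫ g) (ih _ fun j hj => ?_)
    rw [Preadditive.sub_comp, sub_eq_zero]
    by_cases hjj : j = j₀
    · subst hjj
      simpa using hg.symm
    · have : f ≫ p j = 0 := hf j (by simp [hjj, hj])
      simp only [Category.assoc, this, comp_zero]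

end Regular

/-! ### Regularity in semisimple categories and additive envelopes -/

section Envelope

variable {A : Type u} [Category.{v} A] [Preadditive A]

/-- Decomposing source and target reduces to a morphism between simple objects, which is zero or
invertible by Schur's lemma. -/
theorem IsSemisimpleAbelian.isVonNeumannRegularCategory (h : IsSemisimpleAbelian A) :
    IsVonNeumannRegularCategory A := by
  intro X Y f
  have := h.hasKernels
  obtain ⟨m, S, b, hS, ⟨hb⟩, ⟨e⟩⟩ := h.exists_simple_decomposition X
  obtain ⟨n, S', b', hS', ⟨hb'⟩, ⟨e'⟩⟩ := h.exists_simple_decomposition Y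
  refine .of_source S (fun j => b.ι j ≫ e.inv) (fun f hf => ?_) (fun j f => ?_) f
  · rw [← cancel_epi e.inv, comp_zero]
    exact hb.isColimit.hom_ext fun ⟨j⟩ => by simpa using hf j
  refine .of_target S' (fun j => e'.hom ≫ b'.π j) (fun f hf => ?_) (fun k f => ?_) f
  · rw [← cancel_mono e'.hom, zero_comp]
    exact hb'.isLimit.hom_ext fun ⟨j⟩ => by simpa using hf j
  by_cases hf : f = 0
  · rw [hf]; exact .zero _ _
  · have := hS j
    have := hS' k
    have := isIso_of_hom_simple hf
    exact .of_isIso f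

theorem Mat_.eq_zero_of_comp_π {M N : Mat_ A} (f : N ⟶ M)
    (h : ∀ j, f ≫ M.isoBiproductEmbedding.hom ≫ biproduct.π _ j = 0) : f = 0 := by
  rw [← cancel_mono M.isoBiproductEmbedding.hom, zero_comp]
  exact biproduct.hom_ext _ _ fun j => by simpa using h j

theorem Mat_.eq_zero_of_ι_comp {M N : Mat_ A} (f : M ⟶ N)
    (h : ∀ j, (biproduct.ι _ j ≫ M.isoBiproductEmbedding.inv) ≫ f = 0) : f = 0 := by
  rw [← cancel_epi M.isoBiproductEmbedding.inv, comp_zero]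
  exact biproduct.hom_ext' _ _ fun j => by simpa using h j

/-- The componentwise criteria reduce a matrix to single entries, and these come from `A`. -/
theorem IsVonNeumannRegularCategory.mat (h : IsVonNeumannRegularCategory A) :
    IsVonNeumannRegularCategory (Mat_ A) := by
  intro M N f
  refine .of_source _ _ (Mat_.eq_zero_of_ι_comp (M := M)) (fun j f => ?_) f
  refine .of_target _ _ Mat_.eq_zero_of_comp_π (fun k f => ?_) f
  obtain ⟨f, rfl⟩ := (Mat_.embedding A).map_surjective f
  exact (h f).map _

end Envelope

/-! ### Idempotent complete regular categories -/

section IdempotentComplete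

variable {B : Type u} [Category.{v} B] [Preadditive B]

theorem exists_complement [IsIdempotentComplete B] {X : B} (e : X ⟶ X) (he : e ≫ e = e) :
    ∃ (K : B) (i : K ⟶ X) (r : X ⟶ K), i ≫ r = 𝟙 K ∧ r ≫ i = 𝟙 X - e :=
  IsIdempotentComplete.idempotents_split X (𝟙 X - e) (by simp [he])

/-- If `f ≫ g ≫ f = f`, then `f ≫ g` is idempotent and the summand split off by `1 - f ≫ g` is the
kernel of `f`. -/
theorem IsVonNeumannRegularCategory.hasKernels [IsIdempotentComplete B]
    (h : IsVonNeumannRegularCategory B) : HasKernels B where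
  has_limit {X Y} f := by
    obtain ⟨g, hg⟩ := h f
    obtain ⟨K, i, r, hir, hri⟩ := exists_complement (f ≫ g) (by simp [reassoc_of% hg])
    refine HasLimit.mk ⟨_, KernelFork.IsLimit.ofι i ?_ (fun k _ => k ≫ r) ?_ ?_⟩
    · have : (r ≫ i) ≫ f = 0 := by simp [hri, hg]
      simpa [reassoc_of% hir] using i ≫= this
    · intro _ k hk
      simp [hri, reassoc_of% hk]
    · rintro _ k hk m rfl
      simp [hir]

theorem IsVonNeumannRegularCategory.hasCokernels [IsIdempotentComplete B]
    (h : IsVonNeumannRegularCategory B) : HasCokernels B where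
  has_colimit {X Y} f := by
    obtain ⟨g, hg⟩ := h f
    obtain ⟨K, i, r, hir, hri⟩ := exists_complement (g ≫ f) (by simp [hg])
    refine HasColimit.mk ⟨_, CokernelCofork.IsColimit.ofπ r ?_ (fun k _ => i ≫ k) ?_ ?_⟩
    · have : f ≫ r ≫ i = 0 := by simp [hri, hg]
      simpa [hir] using this =≫ r
    · intro _ k hk
      simp [reassoc_of% hri, hk]
    · rintro _ k hk m rfl
      simp [reassoc_of% hir]

/-- A monomorphism `f` has a retraction `g`, so it is the kernel of `1 - g ≫ f`. -/
theorem IsVonNeumannRegularCategory.isNormalMonoCategory (h : IsVonNeumannRegularCategory B) :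
    IsNormalMonoCategory B where
  normalMonoOfMono {X Y} f _ := by
    obtain ⟨g, hg⟩ := h.exists_retraction f
    refine ⟨⟨Y, 𝟙 Y - g ≫ f, by simp [reassoc_of% hg], KernelFork.IsLimit.ofι f _
      (fun k _ => k ≫ g) (fun k hk => ?_) (fun k hk m hm => ?_)⟩⟩
    · rw [Preadditive.comp_sub, sub_eq_zero, Category.comp_id] at hk
      simpa using hk.symm
    · rw [← hm, Category.assoc, hg, Category.comp_id]

theorem IsVonNeumannRegularCategory.isNormalEpiCategory (h : IsVonNeumannRegularCategory B) :
    IsNormalEpiCategory B where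
  normalEpiOfEpi {X Y} f _ := by
    obtain ⟨g, hg⟩ := h f
    replace hg : g ≫ f = 𝟙 Y := by simpa [← cancel_epi f] using hg
    refine ⟨⟨X, 𝟙 X - f ≫ g, by simp [hg], CokernelCofork.IsColimit.ofπ f _
      (fun k _ => g ≫ k) (fun k hk => ?_) (fun k hk m hm => ?_)⟩⟩
    · rw [Preadditive.sub_comp, sub_eq_zero, Category.id_comp] at hk
      simpa using hk.symm
    · rw [← hm, reassoc_of% hg]

/-- `X` is a finite direct sum of simple objects. -/
def IsFiniteSumOfSimples (X : B) : Prop :=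
  ∃ (J : Type) (_ : Fintype J) (Y : J → B) (i : ∀ j, Y j ⟶ X) (p : ∀ j, X ⟶ Y j),
    (∀ j, Simple (Y j)) ∧ (∀ j, i j ≫ p j = 𝟙 (Y j)) ∧ (∀ j k, j ≠ k → i j ≫ p k = 0) ∧
      ∑ j, p j ≫ i j = 𝟙 X

theorem IsFiniteSumOfSimples.exists_bicone {X : B} (h : IsFiniteSumOfSimples X) :
    ∃ (n : ℕ) (Y : Fin n → B) (b : Bicone Y),
      (∀ i, Simple (Y i)) ∧ Nonempty b.IsBilimit ∧ Nonempty (X ≅ b.pt) := by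
  obtain ⟨J, _, Y, i, p, hY, hip, hip', hpi⟩ := h
  let e := (Fintype.equivFin J).symm
  let b : Bicone fun k => Y (e k) :=
    { pt := X
      π := fun k => p (e k)
      ι := fun k => i (e k)
      ι_π := fun k l => by
        by_cases hkl : k = l
        · subst hkl
          simpa using hip _
        · rw [dif_neg hkl]
          exact hip' _ _ (e.injective.ne hkl) }
  refine ⟨_, _, b, fun k => hY _, ⟨isBilimitOfTotal b ?_⟩, ⟨Iso.refl _⟩⟩
  rw [← hpi]
  exact e.sum_comp fun j => p j ≫ i j

theorem IsFiniteSumOfSimples.of_id_eq_zero {X : B} (h : 𝟙 X = 0) : IsFiniteSumOfSimples X :=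
  ⟨Empty, inferInstance, Empty.rec, fun j => j.rec, fun j => j.rec, fun j => j.rec,
    fun j => j.rec, fun j => j.rec, by simp [h]⟩

theorem IsFiniteSumOfSimples.of_simple {X : B} (h : Simple X) : IsFiniteSumOfSimples X :=
  ⟨Unit, inferInstance, fun _ => X, fun _ => 𝟙 X, fun _ => 𝟙 X, fun _ => h, by simp, by simp,
    by simp⟩

theorem IsFiniteSumOfSimples.of_simple_complement {X S K : B} [Simple S]
    (hK : IsFiniteSumOfSimples K) (s : S ⟶ X) (q : X ⟶ S) (i : K ⟶ X) (r : X ⟶ K)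
    (hsq : s ≫ q = 𝟙 S) (hir : i ≫ r = 𝟙 K) (hri : r ≫ i = 𝟙 X - q ≫ s) :
    IsFiniteSumOfSimples X := by
  have hsr : s ≫ r = 0 := by
    have : s ≫ r ≫ i = 0 := by simp [hri, reassoc_of% hsq]
    simpa [hir] using this =≫ r
  have hiq : i ≫ q = 0 := by
    have : (r ≫ i) ≫ q = 0 := by simp [hri, hsq]
    simpa [reassoc_of% hir] using i ≫= this
  obtain ⟨J, _, Y, ι, π, hY, hιπ, hιπ', hπι⟩ := hK
  refine ⟨Option J, inferInstance, fun j => j.elim S Y,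
    fun j => match j with | none => s | some j => ι j ≫ i,
    fun j => match j with | none => q | some j => r ≫ π j, ?_, ?_, ?_, ?_⟩
  · rintro (_ | j)
    · assumption
    · exact hY j
  · rintro (_ | j)
    · exact hsq
    · simpa [reassoc_of% hir] using hιπ j
  · rintro (_ | j) (_ | k) hjk
    · exact absurd rfl hjk
    · exact (by simp [reassoc_of% hsr] : s ≫ r ≫ π k = 0)
    · exact (by simp [hiq] : (ι j ≫ i) ≫ q = 0)
    · have := hιπ' j k (by simpa using hjk)
      exact (by simp [reassoc_of% hir, this] : (ι j ≫ i) ≫ r ≫ π k = 0)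
  · have : ∑ j, (r ≫ π j) ≫ ι j ≫ i = r ≫ i := by
      simpa [Preadditive.sum_comp, Preadditive.comp_sum] using (r ≫= hπι) =≫ i
    rw [Fintype.sum_option]
    exact (congrArg (q ≫ s + ·) this).trans (by rw [hri]; abel)

/-- A nonzero map to a simple object is a split epimorphism by regularity. Splitting it off leaves a
complement on which the remaining maps are still jointly monic, and induction applies. -/
theorem IsFiniteSumOfSimples.of_jointly_mono_simple [IsIdempotentComplete B]
    (h : IsVonNeumannRegularCategory B) {J : Type*} [Finite J] (S : J → B)
    (hS : ∀ j, Simple (S j)) (X : B) (p : ∀ j, X ⟶ S j)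
    (hp : ∀ (W : B) (f : W ⟶ X), (∀ j, f ≫ p j = 0) → f = 0) : IsFiniteSumOfSimples X := by
  classical
  have := h.hasKernels
  have := Fintype.ofFinite J
  suffices H : ∀ (s : Finset J) (X : B) (p : ∀ j, X ⟶ S j),
      (∀ (W : B) (f : W ⟶ X), (∀ j ∈ s, f ≫ p j = 0) → f = 0) → IsFiniteSumOfSimples X from
    H Finset.univ X p fun W f hf => hp W f fun j => hf j (Finset.mem_univ j)
  intro s
  induction s using Finset.induction_on with
  | empty => exact fun X p hp => .of_id_eq_zero (hp X _ (by simp))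
  | insert j s _ ih =>
    intro X p hp
    by_cases hpj : p j = 0
    · exact ih X p fun W f hf => hp W f (by simpa [hpj] using hf)
    obtain ⟨g, hg⟩ := h (p j)
    have := hS j
    have hgp : g ≫ p j ≠ 0 := fun h0 => hpj (by rw [← hg, h0, comp_zero])
    have := isIso_of_hom_simple hgp
    -- An invertible idempotent is the identity.
    have hgp1 : g ≫ p j = 𝟙 _ := by
      rw [← cancel_mono (g ≫ p j)]
      simp [hg]
    obtain ⟨K, i, r, hir, hri⟩ := exists_complement (p j ≫ g) (by simp [reassoc_of% hgp1])
    refine .of_simple_complement (ih K (fun k => i ≫ p k) fun W f hf => ?_) g (p j) i r hgp1 hir hri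
    have hij : i ≫ p j = 0 := by
      have : (r ≫ i) ≫ p j = 0 := by simp [hri, hgp1]
      simpa [reassoc_of% hir] using i ≫= this
    have : f ≫ i = 0 := hp W _ fun k hk => by
      rcases Finset.mem_insert.mp hk with rfl | hk
      · simp [hij]
      · simpa using hf k hk
    simpa [hir] using this =≫ r

theorem IsFiniteSumOfSimples.of_jointly_mono [IsIdempotentComplete B]
    (h : IsVonNeumannRegularCategory B) {J : Type*} [Finite J] (W : J → B)
    (hW : ∀ j, IsFiniteSumOfSimples (W j)) (X : B) (p : ∀ j, X ⟶ W j)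
    (hp : ∀ (V : B) (f : V ⟶ X), (∀ j, f ≫ p j = 0) → f = 0) : IsFiniteSumOfSimples X := by
  choose I _ Y i q hY _ _ hqi using hW
  refine .of_jointly_mono_simple h (fun j : Σ j, I j => Y j.1 j.2) (fun j => hY _ _) X
    (fun j => p j.1 ≫ q j.1 j.2) fun V f hf => hp V f fun j => ?_
  rw [← Category.comp_id (f ≫ p j), ← hqi, Preadditive.comp_sum]
  refine Finset.sum_eq_zero fun k _ => ?_
  have := hf ⟨j, k⟩
  simp only [← Category.assoc] at this ⊢
  rw [this, zero_comp]

/-- Noetherian induction over all summands of `X`, indexed by their idempotents. A nonzero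
non-simple summand splits into two strictly smaller ones. -/
theorem IsFiniteSumOfSimples.of_wellFounded [IsIdempotentComplete B]
    (h : IsVonNeumannRegularCategory B) {X : B} (hX : WellFounded (IdempotentLT (X := X))) :
    IsFiniteSumOfSimples X := by
  suffices H : ∀ (e : X ⟶ X) (Y : B) (i : Y ⟶ X) (r : X ⟶ Y), i ≫ r = 𝟙 Y → r ≫ i = e →
      IsFiniteSumOfSimples Y from H (𝟙 X) X (𝟙 X) (𝟙 X) (by simp) (by simp)
  intro e
  induction e using hX.induction with
  | _ e ih =>
  rintro Y i r hir rfl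
  by_cases hY : 𝟙 Y = 0
  · exact .of_id_eq_zero hY
  by_cases hS : Simple Y
  · exact .of_simple hS
  obtain ⟨Z, f, _, hf0, hfi⟩ : ∃ (Z : B) (f : Z ⟶ Y), Mono f ∧ f ≠ 0 ∧ ¬ IsIso f := by
    by_contra! hcon
    refine hS ⟨fun {Z} f _ => ⟨?_, hcon Z f inferInstance⟩⟩
    rintro hf rfl
    exact hY (by rw [← IsIso.inv_hom_id (0 : Z ⟶ Y), comp_zero])
  obtain ⟨g, hg⟩ := h.exists_retraction f
  obtain ⟨K, k, q, hkq, hqk⟩ := exists_complement (g ≫ f) (by simp [reassoc_of% hg])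
  -- A proper summand of `Y` gives a strictly smaller idempotent of `X`, so the induction hypothesis
  -- covers it.
  have key : ∀ (V : B) (a : V ⟶ Y) (c : Y ⟶ V), a ≫ c = 𝟙 V → c ≫ a ≠ 𝟙 Y →
      IsFiniteSumOfSimples V := by
    intro V a c hac hca
    refine ih (r ≫ c ≫ a ≫ i) ⟨?_, ?_, ?_, ?_, fun heq => hca ?_⟩ V (a ≫ i) (r ≫ c) ?_ ?_
    · simp [reassoc_of% hir, reassoc_of% hac]
    · simp [reassoc_of% hir]
    · simp [reassoc_of% hir]
    · simp [reassoc_of% hir]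
    · have := i ≫= (heq =≫ r)
      simpa [reassoc_of% hir, hir] using this
    · simp [reassoc_of% hir, hac]
    · simp
  have hZ : IsFiniteSumOfSimples Z := key Z f g hg fun hgf => hfi ⟨g, hg, hgf⟩
  have hK : IsFiniteSumOfSimples K := key K k q hkq fun h1 => hf0 (by
    have : g ≫ f = 0 := by rw [h1, eq_sub_iff_add_eq] at hqk; simpa using hqk
    simpa [reassoc_of% hg] using f ≫= this)
  refine .of_jointly_mono h (J := Bool) (fun b => b.rec Z K) (fun b => by cases b <;> assumption) Y
    (fun b => b.rec g q) fun V a ha => ?_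
  have h₁ : a ≫ g = 0 := ha false
  have h₂ : a ≫ q = 0 := ha true
  rw [← Category.comp_id a, ← sub_add_cancel (𝟙 Y) (g ≫ f), ← hqk]
  simp [reassoc_of% h₁, reassoc_of% h₂]

end IdempotentComplete

/-! ### The criterion for the pseudo-abelian envelope -/

/-- The chain condition is needed only on objects of `A`: an object of the envelope is a summand of
a formal direct sum, so its coordinate maps to objects of `A` are jointly monic. -/
theorem IsVonNeumannRegularCategory.isSemisimpleAbelian_pseudoAbelianEnvelope {A : Type u}
    [Category.{v} A] [Preadditive A] (h : IsVonNeumannRegularCategory A)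
    (hA : ∀ a : A, WellFounded (IdempotentLT (X := a))) :
    IsSemisimpleAbelian (PseudoAbelianEnvelope A) := by
  have hB : IsVonNeumannRegularCategory (PseudoAbelianEnvelope A) := h.mat.karoubi
  refine ⟨inferInstance, hB.hasKernels, hB.hasCokernels, hB.isNormalMonoCategory,
    hB.isNormalEpiCategory, fun X => IsFiniteSumOfSimples.exists_bicone ?_⟩
  refine .of_jointly_mono hB
    (fun j => (Idempotents.toKaroubi _).obj ((Mat_.embedding A).obj (X.X.X j))) (fun j => ?_) X
    (fun j => X.decompId_i ≫ (Idempotents.toKaroubi _).map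
      (X.X.isoBiproductEmbedding.hom ≫ biproduct.π _ j)) fun V f hf => ?_
  · exact .of_wellFounded hB (wellFounded_idempotentLT_of_map _ _
      (wellFounded_idempotentLT_of_map _ _ (hA _)))
  · ext1
    refine Mat_.eq_zero_of_comp_π _ fun j => ?_
    simpa using congr_arg Idempotents.Karoubi.Hom.f (hf j)

theorem IsSemisimpleAbelian.isVonNeumannRegularCategory_of_envelope {A : Type u}
    [Category.{v} A] [Preadditive A] (h : IsSemisimpleAbelian (PseudoAbelianEnvelope A)) :
    IsVonNeumannRegularCategory A := fun _ _ _ =>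
  .of_map (Mat_.embedding A) (.of_map (Idempotents.toKaroubi _)
    (h.isVonNeumannRegularCategory _))

/-! ### Constructible sets -/

section Topology

open Topology TopologicalSpace

variable {X : Type*} [TopologicalSpace X]

/-- The frontier of an open set is nowhere dense. This persists under complements, which keep the
frontier, and under finite unions, since a union of two closed sets with empty interior has empty
interior. -/
theorem Topology.IsConstructible.interior_frontier_eq_empty {s : Set X} (hs : IsConstructible s) :
    interior (frontier s) = ∅ := by
  induction hs using IsConstructible.empty_union_induction with
  | open_retrocompact U hU _ => exact interior_frontier (isClosed_compl_iff.mpr hU) ▸ by simp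
  | union s _ t _ hs ht =>
    refine Set.subset_eq_empty (interior_mono (?_ : _ ⊆ frontier s ∪ frontier t)) ?_
    · exact (frontier_union_subset s t).trans
        (Set.union_subset_union Set.inter_subset_left Set.inter_subset_right)
    · rw [interior_union_isClosed_of_interior_empty isClosed_frontier ht, hs]
  | compl s _ hs => rwa [frontier_compl]

/-- For a dense set the frontier is the complement of the interior. -/
theorem Topology.IsConstructible.dense_interior {s : Set X} (hs : IsConstructible s)
    (hs' : Dense s) : Dense (interior s) := by
  rw [← compl_compl (interior s), ← interior_eq_empty_iff_dense_compl,
    ← hs.interior_frontier_eq_empty, frontier, hs'.closure_eq, Set.compl_eq_univ_sdiff]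

theorem Topology.IsConstructible.exists_isLocallyClosed {s : Set X} (hs : IsConstructible s)
    {x : X} (hx : x ∈ s) : ∃ L ⊆ s, x ∈ L ∧ IsLocallyClosed L := by
  -- The claim is proved for `s` and its complement together, so that the induction passes through
  -- complements.
  suffices H : (∀ x ∈ s, ∃ L ⊆ s, x ∈ L ∧ IsLocallyClosed L) ∧
      ∀ x ∈ sᶜ, ∃ L ⊆ sᶜ, x ∈ L ∧ IsLocallyClosed L from H.1 x hx
  clear hx x
  induction hs using IsConstructible.empty_union_induction with
  | open_retrocompact U hU _ =>
    exact ⟨fun x hx => ⟨U, subset_rfl, hx, hU.isLocallyClosed⟩,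
      fun x hx => ⟨Uᶜ, subset_rfl, hx, hU.isClosed_compl.isLocallyClosed⟩⟩
  | union s _ t _ hs ht =>
    refine ⟨?_, fun x hx => ?_⟩
    · rintro x (hx | hx)
      · obtain ⟨L, hL, h⟩ := hs.1 x hx
        exact ⟨L, hL.trans Set.subset_union_left, h⟩
      · obtain ⟨L, hL, h⟩ := ht.1 x hx
        exact ⟨L, hL.trans Set.subset_union_right, h⟩
    · rw [Set.compl_union] at hx ⊢
      obtain ⟨L, hL, hxL, h⟩ := hs.2 x hx.1
      obtain ⟨L', hL', hxL', h'⟩ := ht.2 x hx.2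
      exact ⟨L ∩ L', Set.inter_subset_inter hL hL', ⟨hxL, hxL'⟩, h.inter h'⟩
  | compl s _ hs => exact ⟨hs.2, by simpa using hs.1⟩

theorem Topology.IsConstructible.nonempty_inter_closedPoints [JacobsonSpace X] {s : Set X}
    (hs : IsConstructible s) (hs' : s.Nonempty) : (s ∩ closedPoints X).Nonempty := by
  obtain ⟨x, hx⟩ := hs'
  obtain ⟨L, hL, hxL, h⟩ := hs.exists_isLocallyClosed hx
  exact (_root_.nonempty_inter_closedPoints ⟨x, hxL⟩ h).mono (Set.inter_subset_inter_left _ hL)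

end Topology

/-! ### Schemes of finite type over a noetherian base -/

section FiniteType

variable {S : Scheme.{u}}

/-- An `S`-scheme is of finite type. -/
structure OverIsFiniteType (X : Over S) : Prop where
  locallyOfFiniteType : LocallyOfFiniteType X.hom
  quasiCompact : QuasiCompact X.hom

theorem OverIsFiniteType.isNoetherian [IsNoetherian S] {X : Over S} (hX : OverIsFiniteType X) :
    IsNoetherian X.left := by
  have := hX.1
  have := hX.2
  have := LocallyOfFiniteType.isLocallyNoetherian X.hom
  have := QuasiCompact.compactSpace_of_compactSpace X.hom
  exact ⟨⟩

theorem OverIsFiniteType.locallyOfFiniteType_left {X Y : Over S} (hX : OverIsFiniteType X)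
    (f : X ⟶ Y) : LocallyOfFiniteType f.left := by
  have := hX.1
  rw [← Over.w f] at this
  exact locallyOfFiniteType_of_comp f.left Y.hom

theorem OverIsFiniteType.quasiCompact_left [IsNoetherian S] {X Y : Over S}
    (hX : OverIsFiniteType X) (f : X ⟶ Y) : QuasiCompact f.left :=
  have := hX.isNoetherian
  inferInstance

theorem OverIsFiniteType.mk_id : OverIsFiniteType (Over.mk (𝟙 S)) :=
  ⟨inferInstanceAs (LocallyOfFiniteType (𝟙 S)), inferInstanceAs (QuasiCompact (𝟙 S))⟩

theorem OverIsFiniteType.pullback [IsNoetherian S] {X Y Z : Over S} (hX : OverIsFiniteType X)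
    (hY : OverIsFiniteType Y) (f : X ⟶ Z) (g : Y ⟶ Z) : OverIsFiniteType (pullback f g) := by
  have sq := (IsPullback.of_hasPullback f g).map (Over.forget S)
  have := hX.1
  have := hX.2
  have h₁ : LocallyOfFiniteType (pullback.fst f g).left :=
    MorphismProperty.of_isPullback sq.flip (hY.locallyOfFiniteType_left g)
  have h₂ : QuasiCompact (pullback.fst f g).left :=
    MorphismProperty.of_isPullback sq.flip (hY.quasiCompact_left g)
  constructor <;> rw [← Over.w (pullback.fst f g)] <;> infer_instance

/-- The equalizer is the pullback of the diagonal of `Y` along `(f, g)`. Uniqueness of the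
factorization is not needed later. -/
theorem OverIsFiniteType.exists_equalizer [IsNoetherian S] {X Y : Over S}
    (hX : OverIsFiniteType X) (hY : OverIsFiniteType Y) (f g : X ⟶ Y) :
    ∃ (E : Over S) (i : E ⟶ X), OverIsFiniteType E ∧ i ≫ f = i ≫ g ∧
      ∀ {T : Over S} (t : T ⟶ X), t ≫ f = t ≫ g → ∃ t', t' ≫ i = t := by
  let p : Y ⟶ Over.mk (𝟙 S) := Over.homMk Y.hom
  have hp {W : Over S} (a b : W ⟶ Over.mk (𝟙 S)) : a = b := by
    ext
    simpa using (Over.w a).trans (Over.w b).symm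
  let d : X ⟶ Limits.pullback p p := pullback.lift f g (hp _ _)
  refine ⟨Limits.pullback d (pullback.diagonal p), pullback.fst _ _, hX.pullback hY _ _, ?_, ?_⟩
  · have h := pullback.condition (f := d) (g := pullback.diagonal p)
    have h₁ := h =≫ pullback.fst p p
    have h₂ := h =≫ pullback.snd p p
    simp only [Category.assoc, d, pullback.lift_fst, pullback.lift_snd, pullback.diagonal_fst,
      pullback.diagonal_snd] at h₁ h₂
    rw [h₁, h₂]
  · intro T t ht
    refine ⟨pullback.lift t (t ≫ f) ?_, pullback.lift_fst _ _ _⟩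
    ext1
    · rw [Category.assoc, Category.assoc, pullback.lift_fst, pullback.diagonal_fst,
        Category.comp_id]
    · rw [Category.assoc, Category.assoc, pullback.lift_snd, pullback.diagonal_snd,
        Category.comp_id, ht]

end FiniteType

/-! ### Chains of idempotents -/

section Idempotents

variable {K : Type u} [Field K]

open TopologicalSpace

/-- The underlying point of a rational point of a scheme over a field. -/
def rationalPoint {X : Over (Spec (.of K))} (x : Over.mk (𝟙 (Spec (.of K))) ⟶ X) : X.left :=
  x.left (IsLocalRing.closedPoint K)

theorem left_comp_hom_eq_id {X : Over (Spec (.of K))} (x : Over.mk (𝟙 (Spec (.of K))) ⟶ X) :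
    x.left ≫ X.hom = 𝟙 _ :=
  Over.w x

theorem rationalPoint_comp {X Y : Over (Spec (.of K))} (x : Over.mk (𝟙 (Spec (.of K))) ⟶ X)
    (f : X ⟶ Y) : rationalPoint (x ≫ f) = f.left (rationalPoint x) :=
  Scheme.Hom.comp_apply x.left f.left _

variable [IsAlgClosed K]

theorem rationalPoint_injective {X : Over (Spec (.of K))} (hX : OverIsFiniteType X) :
    Function.Injective (rationalPoint (X := X)) := fun x y h => by
  have := hX.1
  ext1
  exact ext_of_apply_closedPoint_eq X.hom (left_comp_hom_eq_id x) (left_comp_hom_eq_id y) h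

theorem isClosed_rationalPoint {X : Over (Spec (.of K))} (hX : OverIsFiniteType X)
    (x : Over.mk (𝟙 (Spec (.of K))) ⟶ X) : IsClosed {rationalPoint x} :=
  have := hX.1
  (pointEquivClosedPoint X.hom ⟨x.left, left_comp_hom_eq_id x⟩).2

/-- The condition `f ≫ e = f` on `f` is closed in the scheme of endomorphisms of `a`. A smaller
idempotent gives a strictly smaller closed subset, and closed subsets of a noetherian space satisfy
the descending chain condition. -/
theorem SchemeAbCategory.wellFounded_idempotentLT {D : SchemeAbCategory (Spec (.of K))}
    (hD : D.IsFiniteType) (a : D.Sections) : WellFounded (IdempotentLT (X := a)) := by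
  have hmor : OverIsFiniteType D.mor := ⟨hD.3, hD.4⟩
  have hT : OverIsFiniteType (Over.mk (𝟙 (Spec (.of K)))) := .mk_id
  -- `H` is the fibre of `(dom, cod)` over `(a, a)`, `σ f` is the rational point of `f`, and `m c`
  -- is the morphism `f ↦ f ≫ c`.
  let H := pullback (pullback.fst D.dom a.pt ≫ D.cod) a.pt
  have hH : OverIsFiniteType H := (hmor.pullback hT _ _).pullback hT _ _
  have := hH.isNoetherian
  let h : H ⟶ D.mor := pullback.fst _ _ ≫ pullback.fst _ _
  let σ (f : a ⟶ a) : Over.mk (𝟙 (Spec (.of K))) ⟶ H :=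
    pullback.lift (pullback.lift f.pt (𝟙 _) (by rw [f.dom, Category.id_comp])) (𝟙 _)
      (by rw [pullback.lift_fst_assoc, f.cod, Category.id_comp])
  have hσ (f : a ⟶ a) : σ f ≫ h = f.pt := by
    simp only [σ, h]
    rw [pullback.lift_fst_assoc, pullback.lift_fst]
  let q : H ⟶ Over.mk (𝟙 (Spec (.of K))) := pullback.snd _ _
  have hσq (f : a ⟶ a) : σ f ≫ q = 𝟙 _ := pullback.lift_snd _ _ _
  have hq : h ≫ D.cod = q ≫ a.pt := by
    simpa [h, q] using pullback.condition (f := pullback.fst D.dom a.pt ≫ D.cod) (g := a.pt)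
  let m (c : a ⟶ a) : H ⟶ D.mor :=
    pullback.lift h (q ≫ c.pt) (by rw [hq, Category.assoc, c.dom]) ≫ D.comp
  have hm (f c : a ⟶ a) : σ f ≫ m c = (f ≫ c).pt := by
    change _ = pullback.lift f.pt c.pt _ ≫ D.comp
    simp only [m, ← Category.assoc]
    congr 1
    ext1
    · rw [Category.assoc, pullback.lift_fst, pullback.lift_fst, hσ]
    · rw [Category.assoc, pullback.lift_snd, pullback.lift_snd, reassoc_of% hσq]
  let W (e : a ⟶ a) : Closeds H.left :=
    Closeds.closure {x | ∃ f : a ⟶ a, f ≫ e = f ∧ rationalPoint (σ f) = x}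
  -- Taking the closure adds no rational points: the locus where `f ≫ (1 - e)` equals zero is the
  -- preimage of a closed point.
  have hW (e f : a ⟶ a) : rationalPoint (σ f) ∈ W e ↔ f ≫ e = f := by
    refine ⟨fun hf => ?_, fun hf => subset_closure ⟨f, hf, rfl⟩⟩
    have hzero (f : a ⟶ a) : rationalPoint (σ f ≫ m (𝟙 a - e)) = rationalPoint (0 : a ⟶ a).pt ↔
        f ≫ e = f := by
      rw [(rationalPoint_injective hmor).eq_iff, hm, ← InternalCategory.Points.Hom.ext_iff,
        eq_comm (b := f), ← sub_eq_zero (a := f)]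
      simp
    have hV : IsClosed ((m (𝟙 a - e)).left ⁻¹' {rationalPoint (0 : a ⟶ a).pt}) :=
      (isClosed_rationalPoint hmor _).preimage (m (𝟙 a - e)).left.continuous
    have hWV : closure {x | ∃ f : a ⟶ a, f ≫ e = f ∧ rationalPoint (σ f) = x} ⊆
        (m (𝟙 a - e)).left ⁻¹' {rationalPoint (0 : a ⟶ a).pt} := by
      refine closure_minimal ?_ hV
      rintro _ ⟨g, hg, rfl⟩
      simpa [rationalPoint_comp] using (hzero g).mpr hg
    exact (hzero f).mp (by simpa [rationalPoint_comp] using hWV hf)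
  refine Subrelation.wf (fun {e' e} hlt => ?_)
    (InvImage.wf W (wellFounded_lt (α := Closeds H.left)))
  obtain ⟨-, he, he'e, hee', hne⟩ := hlt
  refine lt_of_le_of_ne ?_ fun heq => hne ?_
  · refine Closeds.closure_le.mpr ?_
    rintro _ ⟨f, hf, rfl⟩
    refine (hW e f).mpr ?_
    rw [← hf, Category.assoc, he'e]
  -- If the two closed sets agree, then `e` lies in `W e'`, so `e = e ≫ e' = e'`.
  · rw [← hee', ← hW, heq, hW, he]

end Idempotents

/-! ### Regularity on generalized elements -/

section GeneralizedElements

/-- A generalized element `f` of the morphisms of an internal category is regular if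
`f ≫ (g ≫ f) = f` for a generalized element `g` in the opposite direction. -/
def InternalCategory.IsRegularElement {𝒞 : Type u} [Category.{v} 𝒞] [HasPullbacks 𝒞]
    (C : InternalCategory 𝒞) {T : 𝒞} (f : T ⟶ C.mor) : Prop :=
  ∃ (g : T ⟶ C.mor) (hfg : f ≫ C.cod = g ≫ C.dom) (hgf : g ≫ C.cod = f ≫ C.dom),
    pullback.lift f (pullback.lift g f hgf ≫ C.comp)
      (by rw [Category.assoc, C.comp_dom, pullback.lift_fst_assoc, hfg]) ≫ C.comp = f

variable {𝒞 : Type u} [Category.{v} 𝒞] {𝒟 : Type u'} [Category.{v'} 𝒟] {L : 𝒟 ⥤ 𝒞} {F : 𝒞 ⥤ 𝒟}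
  [HasPullbacks 𝒞] [HasPullbacks 𝒟]

/-- By adjunction, `T`-points of the image under `F` are `L T`-points of the original category.
Regularity of a geometric fibre thus becomes a statement about geometric points of `Mor` itself. -/
theorem InternalCategory.isVonNeumannRegularCategory_points_map_iff (adj : L ⊣ F)
    (C : InternalCategory 𝒞) (T : 𝒟) :
    IsVonNeumannRegularCategory (InternalCategory.Points (C.map adj) T) ↔
      ∀ f : L.obj T ⟶ C.mor, C.IsRegularElement f := by
  have key {a b : InternalCategory.Points (C.map adj) T} (f' : a ⟶ b) (f : L.obj T ⟶ C.mor)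
      (hf : f'.pt = adj.homEquiv T _ f) (g' : b ⟶ a) (g : L.obj T ⟶ C.mor)
      (hg : g'.pt = adj.homEquiv T _ g) (hfg : f ≫ C.cod = g ≫ C.dom)
      (hgf : g ≫ C.cod = f ≫ C.dom) :
      (f' ≫ g' ≫ f').pt = adj.homEquiv T _ (pullback.lift f (pullback.lift g f hgf ≫ C.comp)
        (by rw [Category.assoc, C.comp_dom, pullback.lift_fst_assoc, hfg]) ≫ C.comp) := by
    change pullback.lift f'.pt (pullback.lift g'.pt f'.pt _ ≫
      pullbackToMap adj C.cod C.dom ≫ F.map C.comp) _ ≫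
        pullbackToMap adj C.cod C.dom ≫ F.map C.comp = _
    simp only [hf, hg]
    simp only [lift_homEquiv_comp adj C.comp g f hgf]
    rw [lift_homEquiv_comp adj C.comp]
  constructor
  · intro h f
    let a : InternalCategory.Points (C.map adj) T := ⟨adj.homEquiv T _ (f ≫ C.dom)⟩
    let b : InternalCategory.Points (C.map adj) T := ⟨adj.homEquiv T _ (f ≫ C.cod)⟩
    let f' : a ⟶ b := ⟨adj.homEquiv T _ f, homEquiv_comp_map adj _ _, homEquiv_comp_map adj _ _⟩
    obtain ⟨g', hg'⟩ := h f'
    obtain ⟨g, hg⟩ := exists_homEquiv adj g'.pt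
    have hfg : f ≫ C.cod = g ≫ C.dom := by
      have := g'.dom
      rw [hg] at this
      exact (adj.homEquiv T _).injective (by rw [← homEquiv_comp_map adj g C.dom, this])
    have hgf : g ≫ C.cod = f ≫ C.dom := by
      have := g'.cod
      rw [hg] at this
      exact (adj.homEquiv T _).injective (by rw [← homEquiv_comp_map adj g C.cod, this])
    refine ⟨g, hfg, hgf, (adj.homEquiv T _).injective ?_⟩
    rw [← key f' f rfl g' g hg hfg hgf, hg']
  · intro h a b f'
    obtain ⟨f, hf⟩ := exists_homEquiv adj f'.pt
    obtain ⟨g, hfg, hgf, hg⟩ := h f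
    have hd := f'.dom
    have hc := f'.cod
    rw [hf] at hd hc
    let g' : b ⟶ a := ⟨adj.homEquiv T _ g,
      by rw [homEquiv_comp_map, ← hfg, ← homEquiv_comp_map, hc],
      by rw [homEquiv_comp_map, hgf, ← homEquiv_comp_map, hd]⟩
    refine ⟨g', InternalCategory.Points.hom_ext ?_⟩
    rw [key f' f hf g' g rfl hfg hgf, hg, hf]

end GeneralizedElements

/-! ### The scheme of morphisms with a chosen quasi-inverse -/

namespace SchemeAbCategory

variable {S : Scheme.{u}} {C : SchemeAbCategory S}

theorem IsFiniteType.overIsFiniteType_ob (hC : C.IsFiniteType) : OverIsFiniteType C.ob :=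
  ⟨hC.1, hC.2⟩

theorem IsFiniteType.overIsFiniteType_mor (hC : C.IsFiniteType) : OverIsFiniteType C.mor :=
  ⟨hC.3, hC.4⟩

theorem IsFiniteType.baseChange (hC : C.IsFiniteType) {T : Scheme.{u}} (t : T ⟶ S) :
    (C.baseChange t).IsFiniteType := by
  obtain ⟨_, _, _, _⟩ := hC
  exact ⟨inferInstanceAs (LocallyOfFiniteType (pullback.snd C.ob.hom t)),
    inferInstanceAs (QuasiCompact (pullback.snd C.ob.hom t)),
    inferInstanceAs (LocallyOfFiniteType (pullback.snd C.mor.hom t)),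
    inferInstanceAs (QuasiCompact (pullback.snd C.mor.hom t))⟩

/-- `P` parametrizes pairs `(f, g)` in opposite directions with `f ≫ g ≫ f = f`. It is cut out of
`Mor ×_Ob Mor` by two equalizers: `E` imposes that `g` ends where `f` begins, `P` the regularity
equation. The map `ρ` remembers `f`. -/
theorem IsFiniteType.exists_isRegularElement_iff [IsNoetherian S] (hC : C.IsFiniteType) :
    ∃ (P : Over S) (ρ : P ⟶ C.mor), OverIsFiniteType P ∧
      ∀ {T : Over S} (f : T ⟶ C.mor),
        C.toInternalCategory.IsRegularElement f ↔ ∃ p, p ≫ ρ = f := by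
  have hmor := hC.overIsFiniteType_mor
  let Q := pullback C.cod C.dom
  have hQ : OverIsFiniteType Q := hmor.pullback hmor _ _
  let f₁ : Q ⟶ C.mor := pullback.fst _ _
  let g₁ : Q ⟶ C.mor := pullback.snd _ _
  have hfg₁ : f₁ ≫ C.cod = g₁ ≫ C.dom := pullback.condition
  obtain ⟨E, i, hE, hgf, hi⟩ :=
    hQ.exists_equalizer hC.overIsFiniteType_ob (g₁ ≫ C.cod) (f₁ ≫ C.dom)
  simp only [← Category.assoc] at hgf
  have hfg : (i ≫ f₁) ≫ C.cod = (i ≫ g₁) ≫ C.dom := by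
    rw [Category.assoc, hfg₁, Category.assoc]
  let c : E ⟶ C.mor := pullback.lift (i ≫ f₁) (pullback.lift (i ≫ g₁) (i ≫ f₁) hgf ≫ C.comp)
    (hfg.trans (by
      rw [Category.assoc (pullback.lift _ _ _), C.comp_dom, pullback.lift_fst_assoc])) ≫ C.comp
  have hc {T : Over S} (e : T ⟶ E) (f g : T ⟶ C.mor) (hf : e ≫ i ≫ f₁ = f)
      (hg : e ≫ i ≫ g₁ = g) (hfg' : f ≫ C.cod = g ≫ C.dom) (hgf' : g ≫ C.cod = f ≫ C.dom) :
      e ≫ c = pullback.lift f (pullback.lift g f hgf' ≫ C.comp)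
        (by rw [Category.assoc, C.comp_dom, pullback.lift_fst_assoc, hfg']) ≫ C.comp := by
    simp only [c, ← Category.assoc]
    congr 1
    ext1
    · rw [Category.assoc, pullback.lift_fst, pullback.lift_fst, hf]
    · rw [Category.assoc, pullback.lift_snd, pullback.lift_snd, ← Category.assoc]
      congr 1
      ext1
      · rw [Category.assoc, pullback.lift_fst, pullback.lift_fst, hg]
      · rw [Category.assoc, pullback.lift_snd, pullback.lift_snd, hf]
  obtain ⟨P, j, hP, hj, hj'⟩ := hE.exists_equalizer hmor c (i ≫ f₁)
  refine ⟨P, j ≫ i ≫ f₁, hP, fun {T} f => ⟨?_, ?_⟩⟩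
  · rintro ⟨g, hfg', hgf', h⟩
    obtain ⟨e, he⟩ := hi (pullback.lift f g hfg') (by
      rw [pullback.lift_snd_assoc, pullback.lift_fst_assoc, hgf'])
    have hef : e ≫ i ≫ f₁ = f := by rw [reassoc_of% he, pullback.lift_fst]
    have heg : e ≫ i ≫ g₁ = g := by rw [reassoc_of% he, pullback.lift_snd]
    obtain ⟨p, hp⟩ := hj' e (by rw [hc e f g hef heg hfg' hgf', h, hef])
    exact ⟨p, by rw [reassoc_of% hp, hef]⟩
  · rintro ⟨p, rfl⟩
    have h₁ : (p ≫ j ≫ i ≫ f₁) ≫ C.cod = (p ≫ j ≫ i ≫ g₁) ≫ C.dom := by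
      simpa only [Category.assoc] using (p ≫ j) ≫= hfg
    have h₂ : (p ≫ j ≫ i ≫ g₁) ≫ C.cod = (p ≫ j ≫ i ≫ f₁) ≫ C.dom := by
      simpa only [Category.assoc] using (p ≫ j) ≫= hgf
    refine ⟨p ≫ j ≫ i ≫ g₁, h₁, h₂, ?_⟩
    rw [← hc (p ≫ j) _ _ (Category.assoc _ _ _) (Category.assoc _ _ _) h₁ h₂, Category.assoc, hj]

end SchemeAbCategory

/-! ### Geometric points -/

section GeometricPoints

variable {K : Type u} [Field K] [IsAlgClosed K]

theorem exists_section_of_isConstructible {X : Scheme.{u}} (f : X ⟶ Spec (.of K))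
    [LocallyOfFiniteType f] {E : Set X} (hE : Topology.IsConstructible E) (hE' : E.Nonempty) :
    ∃ p : Spec (.of K) ⟶ X, p ≫ f = 𝟙 _ ∧ ∀ a, p a ∈ E := by
  have := LocallyOfFiniteType.jacobsonSpace f
  obtain ⟨x, hx, hx'⟩ := hE.nonempty_inter_closedPoints hE'
  exact ⟨pointOfClosedPoint f x hx', pointOfClosedPoint_comp f x hx', fun a =>
    (pointOfClosedPoint_apply f x hx' a).symm ▸ hx⟩

/-- The fibre over `y` is nonempty and locally of finite type over an algebraically closed field, so
it has a rational point. -/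
theorem exists_lift_of_mem_range {X Y : Scheme.{u}} (f : X ⟶ Y) [LocallyOfFiniteType f]
    (y : Spec (.of K) ⟶ Y) (hy : y (IsLocalRing.closedPoint K) ∈ Set.range f) :
    ∃ x : Spec (.of K) ⟶ X, x ≫ f = y := by
  obtain ⟨x, hx⟩ := hy
  obtain ⟨z, -⟩ := Scheme.Pullback.exists_preimage_pullback (f := f) (g := y) x
    (IsLocalRing.closedPoint K) hx
  obtain ⟨p, hp, -⟩ := exists_section_of_isConstructible (pullback.snd f y) .univ ⟨z, trivial⟩
  exact ⟨p ≫ pullback.fst f y, by rw [Category.assoc, pullback.condition, reassoc_of% hp]⟩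

theorem exists_lift_of_isConstructible {X S : Scheme.{u}} (f : X ⟶ S) [LocallyOfFiniteType f]
    {E : Set X} (hE : Topology.IsConstructible E) (s : Spec (.of K) ⟶ S) {x : X} (hx : x ∈ E)
    (hxs : f x = s (IsLocalRing.closedPoint K)) :
    ∃ p : Spec (.of K) ⟶ X, p ≫ f = s ∧ p (IsLocalRing.closedPoint K) ∈ E := by
  obtain ⟨z, hz, -⟩ := Scheme.Pullback.exists_preimage_pullback (f := f) (g := s) x
    (IsLocalRing.closedPoint K) hxs
  obtain ⟨p, hp, hpE⟩ := exists_section_of_isConstructible (pullback.snd f s)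
    ((pullback.fst f s).isConstructible_preimage hE) ⟨z, by rwa [Set.mem_preimage, hz]⟩
  exact ⟨p ≫ pullback.fst f s, by rw [Category.assoc, pullback.condition, reassoc_of% hp],
    hpE _⟩

end GeometricPoints

theorem geometricPoint_apply (S : Scheme.{u}) (s : S)
    (x : Spec (CommRingCat.of (AlgebraicClosure (S.residueField s)))) :
    geometricPoint S s x = s := by
  rw [geometricPoint, Scheme.Hom.comp_apply, Scheme.fromSpecResidueField_apply]

/-- `E` is the complement of the image in `S` of the morphisms outside the range of `ρ`. Chevalley's
theorem is applied to `ρ` and then to `Mor ⟶ S`. The lifting lemmas translate between scheme points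
and geometric points. -/
theorem SchemeAbCategory.IsFiniteType.exists_isConstructible {S : Scheme.{u}} [IsNoetherian S]
    {C : SchemeAbCategory S} (hC : C.IsFiniteType) :
    ∃ E : Set S, Topology.IsConstructible E ∧
      ∀ s, s ∈ E ↔ IsVonNeumannRegularCategory (C.GeometricFiber s) := by
  obtain ⟨P, ρ, hP, hρ⟩ := hC.exists_isRegularElement_iff
  have hmor := hC.overIsFiniteType_mor
  have := hmor.isNoetherian
  have := hmor.1
  have := hmor.2
  have := hP.locallyOfFiniteType_left ρ
  have := hP.quasiCompact_left ρ
  have hR : Topology.IsConstructible (Set.range ρ.left) := by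
    rw [← Set.image_univ]
    exact ρ.left.isConstructible_image .univ
  refine ⟨(C.mor.hom '' (Set.range ρ.left)ᶜ)ᶜ, (C.mor.hom.isConstructible_image hR.compl).compl,
    fun s => ?_⟩
  have key := InternalCategory.isVonNeumannRegularCategory_points_map_iff
    (Over.mapPullbackAdj (geometricPoint S s)) C.toInternalCategory
    (Over.mk (𝟙 (Spec (CommRingCat.of (AlgebraicClosure (S.residueField s))))))
  refine Iff.trans ?_ key.symm
  constructor
  · intro hs f
    rw [hρ]
    have hf : f.left ≫ C.mor.hom = geometricPoint S s := (Over.w f).trans (Category.id_comp _)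
    obtain ⟨p, hp⟩ := exists_lift_of_mem_range (K := AlgebraicClosure (S.residueField s)) ρ.left
      f.left (by
        by_contra hcon
        exact hs ⟨_, hcon, (congrArg (fun g : _ ⟶ S => g (IsLocalRing.closedPoint _)) hf).trans
          (geometricPoint_apply S s _)⟩)
    refine ⟨Over.homMk p ?_, by ext1; exact hp⟩
    rw [← Over.w ρ, reassoc_of% hp]
    exact Over.w f
  · rintro h ⟨x, hx, rfl⟩
    -- The geometric point `p` need not lie over `x`; it only has to avoid the range of `ρ` in the
    -- same fibre over `S`.
    obtain ⟨p, hp, hpx⟩ := exists_lift_of_isConstructible C.mor.hom hR.compl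
      (geometricPoint S (C.mor.hom x)) hx (geometricPoint_apply _ _ _).symm
    obtain ⟨q, hq⟩ := (hρ _).mp (h (Over.homMk p (hp.trans (Category.id_comp _).symm)))
    refine hpx ⟨q.left (IsLocalRing.closedPoint _), ?_⟩
    have hq' : q.left ≫ ρ.left = p := congr_arg CommaMorphism.left hq
    rw [← hq']
    rfl

end

theorem mainTheorem1 (S : Scheme.{u}) [IsNoetherian S] (C : SchemeAbCategory S)
    (hC : C.IsFiniteType) (Z : Set S) (hZ : Dense Z)
    (hss : ∀ s ∈ Z, IsSemisimpleAbelian (PseudoAbelianEnvelope (C.GeometricFiber s)))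
    (hend : ∀ s ∈ Z, ∀ X : PseudoAbelianEnvelope (C.GeometricFiber s),
      Subsingleton (End X) ∨ Infinite (End X)) :
    ∃ U : S.Opens, Dense (U : Set S) ∧
      ∀ ξ ∈ U, IsSemisimpleAbelian (PseudoAbelianEnvelope (C.GeometricFiber ξ)) := by
  obtain ⟨E, hE, hEs⟩ := hC.exists_isConstructible
  have hZE : Z ⊆ E := fun s hs =>
    (hEs s).mpr (hss s hs).isVonNeumannRegularCategory_of_envelope
  refine ⟨⟨interior E, isOpen_interior⟩, hE.dense_interior (hZ.mono hZE), fun ξ hξ => ?_⟩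
  exact ((hEs ξ).mp (interior_subset hξ)).isSemisimpleAbelian_pseudoAbelianEnvelope
    (SchemeAbCategory.wellFounded_idempotentLT (hC.baseChange _))
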